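/- Let $\pi^E\colon E\to M$ and $\pi^{E'}\colon E'\to M'$ be smooth real vector bundles of finite rank over finite-dimensional smooth (Hausdorff, boundaryless) manifolds, let $D$ be a compact (Hausdorff) smooth manifold, possibly with boundary, and let $k\ge 2$ be an integer. A connection on $E$ is a smooth map $P^E\colon TE\to E$ such that $P^E$ restricts to a linear map $T_eE\to E_x$ for all $x\in M$, $e\in E_x$, and such that for every local trivialization $s_x\colon\mathbb R^n\to E_x$ ($x\in U$) of $E$ there are bilinear maps $\Gamma_x\colon T_xM\times E_x\to E_x$, depending smoothly on $x\in U$, with $P^E(\eta)=s_x\big(\mathrm d\tilde s_e(\eta)\big)+\Gamma_x\big(\mathrm d\pi^E_e(\eta),e\big)$ for all $x\in U$, $e\in E_x$, $\eta\in T_eE$, where $\tilde s(e)=s_{\pi^E(e)}^{-1}(e)$. If $P^E$, $P^{E'}$ are connections, $f\colon M\to M'$ is smooth and $T\colon E\to E'$ is a smooth vector bundle morphism covering $f$ (i.e. $\pi^{E'}\circ T=f\circ\pi^E$ and $T$ is linear on the fibres), then $T$ is called affine if $P^{E'}\circ\mathrm dT=T\circ P^E$. For a finite-dimensional manifold $N$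 without boundary, $\mathcal C^k(D,N)$ carries its usual Banach manifold structure: for a normalized local addition $\alpha$ on $N$ (such as the exponential map of a connection on $TN$), the inverse of the chart centered at $g$ is $\sigma\mapsto\alpha\circ\sigma$, defined on an open subset of the Banach space of $\mathcal C^k$ sections of $g^*TN$, which is also the tangent space at $g$; thus $T\mathcal C^k(D,N)\cong\mathcal C^k(D,TN)$. Set $\mathcal M=\mathcal C^k(D,M)$, $\mathcal M'=\mathcal C^k(D,M')$, $\mathcal E=\mathcal C^k(D,E)$, $\mathcal E'=\mathcal C^k(D,E')$. Left-composition with $\pi^E$ makes $\mathcal E$ a Banach vector bundle over $\mathcal M$, whose fibre over $g$ is the Banach space of $\mathcal C^k$ sections of $g^*E$. The natural connection $P^{\mathcal E}\colon T\mathcal E\cong\mathcal C^k(D,TE)\to\mathcal E$ induced by $P^E$ is the map of left-composition with $P^E$; similarly for $\mathcal E'$. Suppose that $E$ and $E'$ are endowed with connections $P^E$ and $P^{E'}$, and that $T\colon E\to E'$, covering $f\colon M\to M'$, is affine. Then the map of left-composition $T_*\colon\mathcal E\to\mathcal E'$, $T_*(F)=T\circ F$, covering $f_*\colon\mathcal M\to\mathcal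 M'$, $f_*(g)=f\circ g$, is affine for the natural connections: $f_*$ and $T_*$ are smooth maps of Banach manifolds, $T_*$ covers $f_*$ and is bounded and linear on the fibres, and $P^{\mathcal E'}\circ\mathrm d(T_*)=T_*\circ P^{\mathcal E}$. -/

import Mathlib

open Bundle Set Topology Filter
open scoped Manifold ContDiff

noncomputable section

namespace MappingSpace

/-! ### The Banach space of `C^k` sections of a vector bundle over a compact manifold

For a `C^k` vector bundle `W` over a compact manifold `D` (possibly with boundary) the space
`Cₛ^k⟮I; F, W⟯` of `C^k` sections carries the `C^k` norm: read sections in finitely many charts of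
`D` and trivializations of `W`, and take the supremum of all partial derivatives up to order `k`
over compact sets that cover `D`. Another choice of charts gives an equivalent norm. -/

section SectionNorm

variable {ED : Type*} [NormedAddCommGroup ED] [NormedSpace ℝ ED]
  {HD : Type*} [TopologicalSpace HD] {I : ModelWithCorners ℝ ED HD}
  {D : Type*} [TopologicalSpace D] [ChartedSpace HD D]
  {F : Type*} [NormedAddCommGroup F]
  {W : D → Type*} [TopologicalSpace (TotalSpace F W)]
  [∀ x, TopologicalSpace (W x)] [FiberBundle F W]

variable (HD D F W) in
/-- A finite family of compact sets covering `D`, each of them inside the domain of a preferred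
chart of `D` and of a preferred trivialization of `W`. -/
structure CompactCover where
  /-- the indices of the charts -/
  centers : Finset D
  /-- the compact sets -/
  piece : D → Set D
  isCompact_piece : ∀ c, IsCompact (piece c)
  piece_subset_chart : ∀ c, piece c ⊆ (chartAt HD c).source
  piece_subset_triv : ∀ c, piece c ⊆ (trivializationAt F W c).baseSet
  covers : ∀ x, ∃ c ∈ centers, x ∈ piece c

variable (HD F W) in
theorem nonempty_compactCover [CompactSpace D] [T2Space D] : Nonempty (CompactCover HD D F W) := by
  have h : ∀ c : D, ∃ K ∈ 𝓝 c, K ⊆ (chartAt HD c).source ∩ (trivializationAt F W c).baseSet ∧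
      IsCompact K := fun c => local_compact_nhds <| inter_mem
    ((chartAt HD c).open_source.mem_nhds (mem_chart_source HD c))
    ((trivializationAt F W c).open_baseSet.mem_nhds
      (FiberBundle.mem_baseSet_trivializationAt' c))
  choose K hK hsub hcomp using h
  obtain ⟨t, -, ht⟩ := isCompact_univ.elim_nhds_subcover K (fun x _ => hK x)
  refine ⟨⟨t, K, hcomp, fun c => (hsub c).trans inter_subset_left,
    fun c => (hsub c).trans inter_subset_right, fun x => ?_⟩⟩
  simpa using ht (mem_univ x)

variable (HD F W) in
/-- The finite cover used in the definition of the `C^k` norm. -/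
def compactCover [CompactSpace D] [T2Space D] : CompactCover HD D F W :=
  (nonempty_compactCover HD F W).some

variable [NormedSpace ℝ F] [∀ x, AddCommGroup (W x)] [∀ x, Module ℝ (W x)] [VectorBundle ℝ F W] {k : ℕ}

/-- The coordinate expression of a section in the preferred chart and trivialization at `c`. -/
def localRep (c : D) (s : Cₛ^k⟮I; F, W⟯) (y : ED) : F :=
  (trivializationAt F W c).continuousLinearMapAt ℝ ((extChartAt I c).symm y)
    (s ((extChartAt I c).symm y))

theorem localRep_add (c : D) (s t : Cₛ^k⟮I; F, W⟯) :
    localRep c (s + t) = localRep c s + localRep c t :=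
  funext fun _ => map_add _ _ _

theorem localRep_smul (c : D) (a : ℝ) (s : Cₛ^k⟮I; F, W⟯) :
    localRep c (a • s) = a • localRep c s :=
  funext fun _ => map_smul _ _ _

theorem contDiffWithinAt_localRep [IsManifold I ∞ D] [ContMDiffVectorBundle k F W I] {c x : D}
    (s : Cₛ^k⟮I; F, W⟯) (hx : x ∈ (chartAt HD c).source)
    (hx' : x ∈ (trivializationAt F W c).baseSet) :
    ContDiffWithinAt ℝ k (localRep c s) (range I) (extChartAt I c x) := by
  have h1 := ((trivializationAt F W c).contMDiffAt_section_iff hx').1 (s.contMDiff x)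
  have h2 := ((contMDiffAt_iff_of_mem_source (y := (0 : F)) hx (by rw [chartAt_self_eq]; trivial)).1 h1).2
  have hsrc : x ∈ (extChartAt I c).source := by simpa using hx
  have hxs : (extChartAt I c).symm (extChartAt I c x) = x := (extChartAt I c).left_inv hsrc
  have hev : ∀ y, (extChartAt I c).symm y ∈ (trivializationAt F W c).baseSet →
      localRep c s y = (trivializationAt F W c ⟨_, s ((extChartAt I c).symm y)⟩).2 := by
    intro y hy
    rw [localRep, Trivialization.continuousLinearMapAt_apply, Trivialization.coe_linearMapAt_of_mem _ hy]
  refine h2.congr_of_eventuallyEq ?_ ?_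
  · have hc := (continuousAt_extChartAt_symm' (I := I) hsrc).preimage_mem_nhds
      ((trivializationAt F W c).open_baseSet.mem_nhds (by rwa [hxs]))
    filter_upwards [mem_nhdsWithin_of_mem_nhds hc] with y hy
    exact hev y hy
  · exact hev _ (by rwa [hxs])

variable [CompactSpace D] [T2Space D] [IsManifold I ∞ D] [ContMDiffVectorBundle k F W I]

variable (ED HD F W k) in
/-- The space in which the partial derivatives up to order `k` of a section live, with the
supremum norm. -/
abbrev JetSpace : Type _ :=
  ∀ (c : (compactCover HD F W).centers) (j : Fin (k + 1)),
    C((compactCover HD F W).piece c, ED [×(j : ℕ)]→L[ℝ] F)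

variable (I F W k) in
/-- All partial derivatives up to order `k` of the coordinate expressions of a section. -/
def jetMap : Cₛ^k⟮I; F, W⟯ →ₗ[ℝ] JetSpace ED HD F W k where
  toFun s c j :=
    { toFun := fun x => iteratedFDerivWithin ℝ j (localRep (c : D) s) (range I) (extChartAt I (c : D) x)
      continuous_toFun := by
        rw [continuous_iff_continuousAt]
        intro x
        have hx := (compactCover HD F W).piece_subset_chart c x.2
        have h1 := contDiffWithinAt_localRep s hx
          ((compactCover HD F W).piece_subset_triv c x.2)
        have h2 := h1.iteratedFDerivWithin_right (m := 0) (i := j) I.uniqueDiffOn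
          (by simpa using (by exact_mod_cast Nat.lt_succ_iff.1 j.2 : ((j : ℕ) : ℕ∞ω) ≤ k))
          (extChartAt_target_subset_range (I := I) (c : D)
            ((extChartAt I (c : D)).map_source (by simpa using hx)))
        have h3 : ContinuousAt (extChartAt I (c : D)) (x : D) :=
          continuousAt_extChartAt' (by simpa using hx)
        refine h2.continuousWithinAt.tendsto.comp (tendsto_nhdsWithin_iff.2
          ⟨h3.tendsto.comp continuousAt_subtype_val, ?_⟩)
        exact Eventually.of_forall fun y => extChartAt_target_subset_range (I := I) (c : D)
            ((extChartAt I (c : D)).map_source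
              (by simpa using (compactCover HD F W).piece_subset_chart c y.2)) }
  map_add' s t := by
    funext c j
    ext1 x
    have hj : ((j : ℕ) : ℕ∞ω) ≤ k := by exact_mod_cast Nat.lt_succ_iff.1 j.2
    have hx := (compactCover HD F W).piece_subset_chart c x.2
    have hx' := (compactCover HD F W).piece_subset_triv c x.2
    change iteratedFDerivWithin ℝ j (localRep (c : D) (s + t)) (range I) _ = _
    rw [localRep_add, iteratedFDerivWithin_add_apply
      ((contDiffWithinAt_localRep s hx hx').of_le hj)
      ((contDiffWithinAt_localRep t hx hx').of_le hj) I.uniqueDiffOn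
      (extChartAt_target_subset_range (I := I) (c : D)
            ((extChartAt I (c : D)).map_source (by simpa using hx)))]
    rfl
  map_smul' a s := by
    funext c j
    ext1 x
    have hj : ((j : ℕ) : ℕ∞ω) ≤ k := by exact_mod_cast Nat.lt_succ_iff.1 j.2
    have hx := (compactCover HD F W).piece_subset_chart c x.2
    have hx' := (compactCover HD F W).piece_subset_triv c x.2
    change iteratedFDerivWithin ℝ j (localRep (c : D) (a • s)) (range I) _ = _
    rw [localRep_smul, iteratedFDerivWithin_const_smul_apply
      ((contDiffWithinAt_localRep s hx hx').of_le hj) I.uniqueDiffOn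
      (extChartAt_target_subset_range (I := I) (c : D)
            ((extChartAt I (c : D)).map_source (by simpa using hx)))]
    rfl

theorem jetMap_injective : Function.Injective (jetMap I F W k) := by
  rw [← LinearMap.ker_eq_bot, LinearMap.ker_eq_bot']
  intro s hs
  ext x
  obtain ⟨c, hc, hx⟩ := (compactCover HD F W).covers x
  have h := DFunLike.congr_fun (congrFun (congrFun hs ⟨c, hc⟩) 0) ⟨x, hx⟩
  have h0 := congrArg (fun m => m (fun i => i.elim0)) h
  have h1 : localRep c s (extChartAt I c x) = 0 := h0
  have hb := (compactCover HD F W).piece_subset_triv c hx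
  have hxs : (extChartAt I c).symm (extChartAt I c x) = x := (extChartAt I c).left_inv
    (by simpa using (compactCover HD F W).piece_subset_chart c hx)
  rw [localRep, hxs] at h1
  have h2 := congrArg ((trivializationAt F W c).symmL ℝ x) h1
  rw [Trivialization.symmL_continuousLinearMapAt _ hb] at h2
  simpa using h2

instance compactSpacePiece (c : D) : CompactSpace ((compactCover HD F W).piece c) :=
  isCompact_iff_compactSpace.1 ((compactCover HD F W).isCompact_piece c)

/-- The `C^k` norm on the space of `C^k` sections over a compact manifold. -/
instance sectionNormedAddCommGroup : NormedAddCommGroup Cₛ^k⟮I; F, W⟯ :=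
  NormedAddCommGroup.induced _ _ (jetMap I F W k) jetMap_injective

instance sectionNormedSpace : NormedSpace ℝ Cₛ^k⟮I; F, W⟯ :=
  NormedSpace.induced ℝ _ _ (jetMap I F W k)

end SectionNorm

/-! ### The Banach manifold `C^k(D, N)` -/

section MappingManifold

variable {ED : Type*} [NormedAddCommGroup ED] [NormedSpace ℝ ED]
  {HD : Type*} [TopologicalSpace HD] {I : ModelWithCorners ℝ ED HD}
  {D : Type*} [TopologicalSpace D] [ChartedSpace HD D]
  {EN : Type*} [NormedAddCommGroup EN] [NormedSpace ℝ EN]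
  {HN : Type*} [TopologicalSpace HN] {J : ModelWithCorners ℝ EN HN}
  {N : Type*} [TopologicalSpace N] [ChartedSpace HN N]
  {EN' : Type*} [NormedAddCommGroup EN'] [NormedSpace ℝ EN']
  {HN' : Type*} [TopologicalSpace HN'] {J' : ModelWithCorners ℝ EN' HN'}
  {N' : Type*} [TopologicalSpace N'] [ChartedSpace HN' N']
  {F : Type*} [NormedAddCommGroup F] [NormedSpace ℝ F]
  {V : N → Type*} [TopologicalSpace (TotalSpace F V)] [∀ x, TopologicalSpace (V x)]
  [∀ x, AddCommGroup (V x)] [FiberBundle F V] {k : ℕ}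

instance pullbackAddCommGroup {B B' : Type*} (g : B' → B) (U : B → Type*) [∀ x, AddCommGroup (U x)] (p : B') :
    AddCommGroup ((g *ᵖ U) p) :=
  inferInstanceAs (AddCommGroup (U (g p)))

/-- `C^k` sections of the bundle `V` along `g`, that is, of the pull-back bundle `g^* V`. -/
abbrev SectionAlong (F : Type*) [NormedAddCommGroup F] [NormedSpace ℝ F]
    (V : N → Type*) [TopologicalSpace (TotalSpace F V)] [∀ x, TopologicalSpace (V x)]
    [∀ x, AddCommGroup (V x)] [FiberBundle F V] (g : C^k⟮I, D; J, N⟯) : Type _ :=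
  Cₛ^k⟮I; F, ((g : C^k⟮I, D; J, N⟯) *ᵖ V)⟯

/-- The inclusion of the space of sections along `g` into `C^k(D, V)`: a section along `g` is seen
as a map into the total space. The range is the fibre over `g` of `C^k(D, V) → C^k(D, N)`. -/
def SectionAlong.toMap {g : C^k⟮I, D; J, N⟯} (s : SectionAlong F V g) :
    C^k⟮I, D; J.prod 𝓘(ℝ, F), TotalSpace F V⟯ where
  val p := ⟨g p, s p⟩
  property p := by
    rw [contMDiffAt_totalSpace]
    exact ⟨g.contMDiff p, (contMDiffAt_section (F := F) (E := g *ᵖ V) p).1 (s.contMDiff p)⟩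

/-- A point of the total space over `x` is an element of the fibre over `x`. -/
def fibreCast {B : Type*} {F : Type*} {U : B → Type*} (v : TotalSpace F U) {x : B}
    (h : v.proj = x) : U x :=
  h ▸ v.2

theorem mk_fibreCast {B : Type*} {F : Type*} {U : B → Type*} (v : TotalSpace F U) {x : B}
    (h : v.proj = x) : (⟨x, fibreCast v h⟩ : TotalSpace F U) = v := by
  subst h
  rfl

/-- A `C^k` map into the total space whose values lie over those of `g` is a section along `g`. -/
def SectionAlong.ofMap {g : C^k⟮I, D; J, N⟯} (S : C^k⟮I, D; J.prod 𝓘(ℝ, F), TotalSpace F V⟯)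
    (hS : ∀ p, (S p).proj = g p) : SectionAlong F V g where
  toFun p := fibreCast (S p) (hS p)
  contMDiff_toFun p := by
    have h1 : (fun q => (⟨g q, fibreCast (S q) (hS q)⟩ : TotalSpace F V)) = S :=
      funext fun q => mk_fibreCast _ _
    have h2 := S.contMDiff p
    rw [← h1] at h2
    exact (contMDiffAt_section (F := F) (E := g *ᵖ V) p).2 (contMDiffAt_totalSpace.1 h2).2

theorem SectionAlong.toMap_ofMap {g : C^k⟮I, D; J, N⟯}
    (S : C^k⟮I, D; J.prod 𝓘(ℝ, F), TotalSpace F V⟯) (hS : ∀ p, (S p).proj = g p) :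
    (SectionAlong.ofMap S hS).toMap = S :=
  DFunLike.ext _ _ fun _ => mk_fibreCast _ _

theorem SectionAlong.toMap_injective {g : C^k⟮I, D; J, N⟯} :
    Function.Injective (SectionAlong.toMap : SectionAlong F V g → _) := by
  intro s t h
  ext p
  have := DFunLike.congr_fun h p
  exact eq_of_heq (TotalSpace.mk.inj this).2

variable [IsManifold J ∞ N] [IsManifold J' ∞ N']

variable (J N) in
/-- A (normalized) local addition on `N`: a diffeomorphism `v ↦ (x, α v)`, for `v` a tangent vector
at `x`, from an open subset of `TN` onto an open subset of `N × N`, such that `α 0_x = x` and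
the derivative at `0_x` of the restriction of `α` to `T_x N` is the identity. The standard example is
the exponential map of a connection on `TN` (near the zero section). It may be defined over an open
subset of `N` only. -/
structure LocalAddition where
  /-- the map `v ↦ (x, α v)` -/
  toHomeo : OpenPartialHomeomorph (TangentBundle J N) (N × N)
  contMDiffOn : ContMDiffOn J.tangent (J.prod J) ∞ toHomeo toHomeo.source
  contMDiffOn_symm : ContMDiffOn (J.prod J) J.tangent ∞ toHomeo.symm toHomeo.target
  fst_apply : ∀ v ∈ toHomeo.source, (toHomeo v).1 = v.proj
  apply_zero : ∀ x, (⟨x, 0⟩ : TangentBundle J N) ∈ toHomeo.source → toHomeo ⟨x, 0⟩ = (x, x)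
  hasMFDerivAt_zero : ∀ x, (⟨x, 0⟩ : TangentBundle J N) ∈ toHomeo.source →
    HasMFDerivAt 𝓘(ℝ, EN) J (fun v : EN => (toHomeo (⟨x, v⟩ : TangentBundle J N)).2) 0
      (ContinuousLinearMap.id ℝ EN)

/-- The tangent space of `C^k(D, N)` at `g`: the Banach space of `C^k` sections of `TN` along
`g`. -/
abbrev Tangent (g : C^k⟮I, D; J, N⟯) : Type _ :=
  SectionAlong EN (TangentSpace J : N → Type _) g

namespace LocalAddition

/-- The local addition is defined over the image of `g`, so that it gives a chart centered at
`g`. -/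
def IsDefinedAlong (e : LocalAddition J N) (g : C^k⟮I, D; J, N⟯) : Prop :=
  ∀ p, (⟨g p, 0⟩ : TangentBundle J N) ∈ e.toHomeo.source

theorem proj_symm (e : LocalAddition J N) {x y : N} (h : (x, y) ∈ e.toHomeo.target) :
    (e.toHomeo.symm (x, y)).proj = x := by
  rw [← e.fst_apply _ (e.toHomeo.map_target h), e.toHomeo.right_inv h]

theorem mk_snd_apply (e : LocalAddition J N) {v : TangentBundle J N} (h : v ∈ e.toHomeo.source) :
    (v.proj, (e.toHomeo v).2) = e.toHomeo v :=
  Prod.ext (e.fst_apply _ h).symm rfl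

/-- The map `p ↦ α (S p)`. -/
def applyMap (e : LocalAddition J N) (S : C^k⟮I, D; J.tangent, TangentBundle J N⟯)
    (hS : ∀ p, S p ∈ e.toHomeo.source) : C^k⟮I, D; J, N⟯ where
  val p := (e.toHomeo (S p)).2
  property := contMDiff_snd.comp
    ((e.contMDiffOn.of_le (mod_cast le_top)).comp_contMDiff S.contMDiff hS)

/-- The map whose value at `p` is the tangent vector `v` at `g p` with `α v = h p`. -/
def symmMap (e : LocalAddition J N) (g h : C^k⟮I, D; J, N⟯)
    (hh : ∀ p, (g p, h p) ∈ e.toHomeo.target) : C^k⟮I, D; J.tangent, TangentBundle J N⟯ where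
  val p := e.toHomeo.symm (g p, h p)
  property := (e.contMDiffOn_symm.of_le (mod_cast le_top)).comp_contMDiff
    (g.contMDiff.prodMk h.contMDiff) hh

theorem proj_symmMap (e : LocalAddition J N) {g h : C^k⟮I, D; J, N⟯}
    (hh : ∀ p, (g p, h p) ∈ e.toHomeo.target) (p : D) : (e.symmMap g h hh p).proj = g p :=
  e.proj_symm (hh p)

open Classical in
/-- The chart of the Banach manifold `C^k(D, N)` given by a local addition `α` and centered at
`g`. It is defined on the set of all `h` such that every `(g p, h p)` lies in the range of
`v ↦ (x, α v)`, and its inverse sends a section `σ` of `TN` along `g` to the map `p ↦ α (σ p)`. -/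
def chart (e : LocalAddition J N) (g : C^k⟮I, D; J, N⟯) :
    PartialEquiv C^k⟮I, D; J, N⟯ (Tangent g) where
  toFun h :=
    if hh : ∀ p, (g p, h p) ∈ e.toHomeo.target then
      SectionAlong.ofMap (e.symmMap g h hh) (e.proj_symmMap hh)
    else 0
  invFun σ :=
    if hσ : ∀ p, σ.toMap p ∈ e.toHomeo.source then e.applyMap σ.toMap hσ else g
  source := {h | ∀ p, (g p, h p) ∈ e.toHomeo.target}
  target := {σ | ∀ p, σ.toMap p ∈ e.toHomeo.source}
  map_source' h hh := by
    have hh' : ∀ p, (g p, h p) ∈ e.toHomeo.target := hh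
    intro p
    rw [dif_pos hh', SectionAlong.toMap_ofMap]
    exact e.toHomeo.map_target (hh p)
  map_target' σ hσ := by
    have hσ' : ∀ p, σ.toMap p ∈ e.toHomeo.source := hσ
    intro p
    rw [dif_pos hσ']
    change ((σ.toMap p).proj, (e.toHomeo (σ.toMap p)).2) ∈ e.toHomeo.target
    rw [e.mk_snd_apply (hσ p)]
    exact e.toHomeo.map_source (hσ p)
  left_inv' h hh := by
    have hh' : ∀ p, (g p, h p) ∈ e.toHomeo.target := hh
    have hs : ∀ p, (SectionAlong.ofMap (g := g) (e.symmMap g h hh)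
        (e.proj_symmMap hh)).toMap p ∈ e.toHomeo.source := fun p => by
      rw [SectionAlong.toMap_ofMap]
      exact e.toHomeo.map_target (hh p)
    simp only [dif_pos hh']
    rw [dif_pos hs]
    refine DFunLike.ext _ _ fun p => ?_
    change (e.toHomeo ((SectionAlong.ofMap (g := g) (e.symmMap g h hh)
        (e.proj_symmMap hh)).toMap p)).2 = h p
    rw [SectionAlong.toMap_ofMap]
    change (e.toHomeo (e.toHomeo.symm (g p, h p))).2 = h p
    rw [e.toHomeo.right_inv (hh p)]
  right_inv' σ hσ := by
    have hσ' : ∀ p, σ.toMap p ∈ e.toHomeo.source := hσ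
    have hs : ∀ p, (g p, e.applyMap σ.toMap hσ p) ∈ e.toHomeo.target := fun p => by
      change ((σ.toMap p).proj, (e.toHomeo (σ.toMap p)).2) ∈ e.toHomeo.target
      rw [e.mk_snd_apply (hσ p)]
      exact e.toHomeo.map_source (hσ p)
    simp only [dif_pos hσ']
    rw [dif_pos hs]
    apply SectionAlong.toMap_injective
    rw [SectionAlong.toMap_ofMap]
    refine DFunLike.ext _ _ fun p => ?_
    change e.toHomeo.symm ((σ.toMap p).proj, (e.toHomeo (σ.toMap p)).2) = σ.toMap p
    rw [e.mk_snd_apply (hσ p), e.toHomeo.left_inv (hσ p)]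

end LocalAddition

variable [CompactSpace D] [T2Space D] [IsManifold I ∞ D]

/-- A map `G : C^k(D, N) → C^k(D, N')` is smooth at `g` if for all charts centered at `g` and at
`G g` it maps a neighbourhood of `g` into the domain of the second chart, and its expression in the
charts, a map between Banach spaces, is smooth at the point `0` corresponding to `g`. -/
def SmoothAt (G : C^k⟮I, D; J, N⟯ → C^k⟮I, D; J', N'⟯) (g : C^k⟮I, D; J, N⟯) : Prop :=
  ∀ (e : LocalAddition J N) (e' : LocalAddition J' N'),
    e.IsDefinedAlong g → e'.IsDefinedAlong (G g) →
      (∀ᶠ σ in 𝓝 (0 : Tangent g), G ((e.chart g).symm σ) ∈ (e'.chart (G g)).source) ∧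
      ContDiffAt ℝ ∞ (fun σ : Tangent g => e'.chart (G g) (G ((e.chart g).symm σ))) 0

/-- Smooth maps between the Banach manifolds `C^k(D, N)` and `C^k(D, N')`. -/
def Smooth (G : C^k⟮I, D; J, N⟯ → C^k⟮I, D; J', N'⟯) : Prop := ∀ g, SmoothAt G g

/-- `L` is the differential of `G` at `g`: the derivative at `0` of the expression of `G` in all
charts centered at `g` and at `G g`. (Since local additions are normalized, the differential at `g`
of a chart centered at `g` is the identity of the tangent space.) -/
def HasDifferentialAt (G : C^k⟮I, D; J, N⟯ → C^k⟮I, D; J', N'⟯) (g : C^k⟮I, D; J, N⟯)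
    (L : Tangent g →L[ℝ] Tangent (G g)) : Prop :=
  ∀ (e : LocalAddition J N) (e' : LocalAddition J' N'),
    e.IsDefinedAlong g → e'.IsDefinedAlong (G g) →
      HasFDerivAt (fun σ : Tangent g => e'.chart (G g) (G ((e.chart g).symm σ))) L 0

end MappingManifold

/-! ### Connections and affine maps -/

section Affine

variable {EM : Type*} [NormedAddCommGroup EM] [NormedSpace ℝ EM]
  {HM : Type*} [TopologicalSpace HM] {IM : ModelWithCorners ℝ EM HM}
  {M : Type*} [TopologicalSpace M] [ChartedSpace HM M]
  {F : Type*} [NormedAddCommGroup F] [NormedSpace ℝ F]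
  {V : M → Type*} [TopologicalSpace (TotalSpace F V)] [∀ x, TopologicalSpace (V x)]
  [∀ x, AddCommGroup (V x)] [∀ x, Module ℝ (V x)] [∀ x, IsTopologicalAddGroup (V x)]
  [∀ x, ContinuousSMul ℝ (V x)] [FiberBundle F V] [VectorBundle ℝ F V]
  [IsManifold IM ∞ M] [ContMDiffVectorBundle ∞ F V IM]
  {EM' : Type*} [NormedAddCommGroup EM'] [NormedSpace ℝ EM']
  {HM' : Type*} [TopologicalSpace HM'] {IM' : ModelWithCorners ℝ EM' HM'}
  {M' : Type*} [TopologicalSpace M'] [ChartedSpace HM' M']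
  {F' : Type*} [NormedAddCommGroup F'] [NormedSpace ℝ F']
  {V' : M' → Type*} [TopologicalSpace (TotalSpace F' V')] [∀ x, TopologicalSpace (V' x)]
  [∀ x, AddCommGroup (V' x)] [∀ x, Module ℝ (V' x)] [∀ x, IsTopologicalAddGroup (V' x)]
  [∀ x, ContinuousSMul ℝ (V' x)] [FiberBundle F' V'] [VectorBundle ℝ F' V']
  [IsManifold IM' ∞ M'] [ContMDiffVectorBundle ∞ F' V' IM']

variable (IM F V) in
/-- A connection on the vector bundle `V → M` with total space `E`: a smooth map `P : TE → E` that
maps `T_e E` linearly to the fibre of `E` through `e`, and such that, for every local trivialization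
`t`, there is a smooth field of bilinear maps `Γ_x : T_x M × V_x → V_x` over the domain of `t` with
`P η = t_x⁻¹ (d(t₂)_e η) + Γ_x (dπ_e η, e)` for `η ∈ T_e E`, where `x = π e` and `t₂` is the fibre
coordinate of `t`. -/
structure Connection where
  /-- the linear maps `T_e E → V_{π e}` -/
  toLin : ∀ e : TotalSpace F V, TangentSpace (IM.prod 𝓘(ℝ, F)) e →ₗ[ℝ] V e.proj
  contMDiff_toMap : ContMDiff (IM.prod 𝓘(ℝ, F)).tangent (IM.prod 𝓘(ℝ, F)) ∞
    (fun η : TangentBundle (IM.prod 𝓘(ℝ, F)) (TotalSpace F V) =>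
      (⟨η.proj.proj, toLin η.proj η.2⟩ : TotalSpace F V))
  exists_christoffel : ∀ (t : Trivialization F (π F V)) [MemTrivializationAtlas t],
    ∃ Γ : ∀ x, TangentSpace IM x →L[ℝ] V x →L[ℝ] V x,
      ContMDiffOn IM (IM.prod 𝓘(ℝ, EM →L[ℝ] F →L[ℝ] F)) ∞
        (fun x => (⟨x, Γ x⟩ : TotalSpace (EM →L[ℝ] F →L[ℝ] F)
          (fun x => TangentSpace IM x →L[ℝ] V x →L[ℝ] V x))) t.baseSet ∧
      ∀ (e : TotalSpace F V), e.proj ∈ t.baseSet → ∀ η : TangentSpace (IM.prod 𝓘(ℝ, F)) e,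
        toLin e η =
          t.symm e.proj (mfderiv (IM.prod 𝓘(ℝ, F)) 𝓘(ℝ, F) (fun e' => (t e').2) e η) +
            Γ e.proj (mfderiv (IM.prod 𝓘(ℝ, F)) IM (π F V) e η) e.2

/-- The map `P : TE → E` of a connection. -/
def Connection.toMap (P : Connection IM F V) :
    C^∞⟮(IM.prod 𝓘(ℝ, F)).tangent, TangentBundle (IM.prod 𝓘(ℝ, F)) (TotalSpace F V);
      IM.prod 𝓘(ℝ, F), TotalSpace F V⟯ :=
  ⟨fun η => ⟨η.proj.proj, P.toLin η.proj η.2⟩, P.contMDiff_toMap⟩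

/-- A smooth map `T` between the total spaces of two vector bundles is affine, as a map covering
`f` and with respect to two connections, if it is a bundle morphism covering `f` and
`P' ∘ dT = T ∘ P`. -/
structure IsAffine (P : Connection IM F V) (P' : Connection IM' F' V')
    (T : C^∞⟮IM.prod 𝓘(ℝ, F), TotalSpace F V; IM'.prod 𝓘(ℝ, F'), TotalSpace F' V'⟯)
    (f : C^∞⟮IM, M; IM', M'⟯) : Prop where
  proj_eq : ∀ e, (T e).proj = f e.proj
  linear : ∀ x, ∃ L : V x →L[ℝ] V' (f x), ∀ v, T ⟨x, v⟩ = ⟨f x, L v⟩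
  comm : ∀ η : TangentBundle (IM.prod 𝓘(ℝ, F)) (TotalSpace F V),
    P'.toMap (tangentMap (IM.prod 𝓘(ℝ, F)) (IM'.prod 𝓘(ℝ, F')) T η) = T (P.toMap η)

variable {ED : Type*} [NormedAddCommGroup ED] [NormedSpace ℝ ED]
  {HD : Type*} [TopologicalSpace HD] {I : ModelWithCorners ℝ ED HD}
  {D : Type*} [TopologicalSpace D] [ChartedSpace HD D] {k : ℕ}
  {EN : Type*} [NormedAddCommGroup EN] [NormedSpace ℝ EN]
  {HN : Type*} [TopologicalSpace HN] {J : ModelWithCorners ℝ EN HN}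
  {N : Type*} [TopologicalSpace N] [ChartedSpace HN N]
  {EN' : Type*} [NormedAddCommGroup EN'] [NormedSpace ℝ EN']
  {HN' : Type*} [TopologicalSpace HN'] {J' : ModelWithCorners ℝ EN' HN'}
  {N' : Type*} [TopologicalSpace N'] [ChartedSpace HN' N']

/-- The map `T_* : C^k(D, N) → C^k(D, N')` of left-composition with a smooth map `T`. -/
def compLeft (T : C^∞⟮J, N; J', N'⟯) (g : C^k⟮I, D; J, N⟯) : C^k⟮I, D; J', N'⟯ :=
  ⟨fun p => T (g p), (T.contMDiff.of_le (mod_cast le_top)).comp g.contMDiff⟩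

variable (IM F V) in
/-- The projection of a vector bundle, as a smooth map. -/
def bundleProj : C^∞⟮IM.prod 𝓘(ℝ, F), TotalSpace F V; IM, M⟯ :=
  ⟨π F V, contMDiff_proj V⟩

/-- The natural connection on `C^k(D, E) → C^k(D, M)`: the map of left-composition with `P`, where
the tangent space of `C^k(D, E)` at `S` is identified with the space of `C^k` sections of `TE` along
`S`; it takes values in the fibre through `S`, the space of `C^k` sections of `E` along `π ∘ S`. -/
def naturalConnection (P : Connection IM F V)
    (S : C^k⟮I, D; IM.prod 𝓘(ℝ, F), TotalSpace F V⟯) :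
    Tangent S →ₗ[ℝ] SectionAlong F V (compLeft (bundleProj IM F V) S) where
  toFun η := SectionAlong.ofMap (compLeft P.toMap η.toMap) (fun _ => rfl)
  map_add' η ζ := by
    ext p
    exact (P.toLin (S p)).map_add (η p) (ζ p)
  map_smul' c η := by
    ext p
    exact (P.toLin (S p)).map_smul c (η p)

variable [CompactSpace D] [T2Space D] [IsManifold I ∞ D]

/-- Let `C^k(D, E) → C^k(D, M)` and `C^k(D, E') → C^k(D, M')` be endowed with connections, given as
families of maps `Q S` from the tangent space at `S` to the fibre through `S`. A map `τ` from
`C^k(D, E)` to `C^k(D, E')` covering `φ` is affine if it is a smooth morphism of Banach bundles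
covering the smooth map `φ`, and `Q' ∘ dτ = τ ∘ Q`. -/
structure IsAffineMap
    (Q : ∀ S : C^k⟮I, D; IM.prod 𝓘(ℝ, F), TotalSpace F V⟯,
      Tangent S →ₗ[ℝ] SectionAlong F V (compLeft (bundleProj IM F V) S))
    (Q' : ∀ S : C^k⟮I, D; IM'.prod 𝓘(ℝ, F'), TotalSpace F' V'⟯,
      Tangent S →ₗ[ℝ] SectionAlong F' V' (compLeft (bundleProj IM' F' V') S))
    (τ : C^k⟮I, D; IM.prod 𝓘(ℝ, F), TotalSpace F V⟯ →
      C^k⟮I, D; IM'.prod 𝓘(ℝ, F'), TotalSpace F' V'⟯)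
    (φ : C^k⟮I, D; IM, M⟯ → C^k⟮I, D; IM', M'⟯) : Prop where
  smooth_base : Smooth φ
  smooth_total : Smooth τ
  proj_eq : ∀ S, compLeft (bundleProj IM' F' V') (τ S) = φ (compLeft (bundleProj IM F V) S)
  linear : ∀ g, ∃ L : SectionAlong F V g →L[ℝ] SectionAlong F' V' (φ g),
    ∀ s, τ s.toMap = (L s).toMap
  comm : ∀ S, ∃ L : Tangent S →L[ℝ] Tangent (τ S), HasDifferentialAt τ S L ∧
    ∀ η, (Q' (τ S) (L η)).toMap = τ (Q S η).toMap

end Affine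

end MappingSpace

end

/-!
The point is the smoothness of left-composition `s ↦ Ψ ∘ s` between Banach spaces of `C^k` sections,
for a smooth map `Ψ` between total spaces of vector bundles that is defined near the image of a given
section (`contDiffAt_of_toMap_eq`, the omega lemma). In the charts of `C^k(D, N)` given by local
additions `e` and `e'`, left-composition with `f` is exactly of this form, with
`Ψ = e'⁻¹ ∘ (f × f) ∘ e` a smooth map between open parts of tangent bundles (`LocalAddition.lift`).
The same lemma shows that a bundle morphism acts continuously on sections (`morphismL`).

The omega lemma rests on the following facts.

* The `C^k` norm, defined by means of one finite cover, controls the derivatives of sections near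
  every point in all charts and trivializations (`exists_norm_chartDeriv_coord_le`).
* The space of `C^k` sections is complete (`completeSpace_section`), so the map to the tuple of all
  partial derivatives is an embedding of Banach spaces with closed range, and smoothness may be
  tested after it (`contDiffAt_of_comp_of_bound`). In this way it suffices to show that each partial
  derivative of `Ψ ∘ s`, an element of some `C(K, Z)` with `K` compact, depends smoothly on `s`, and
  this is local on `K` (`contDiffAt_of_restrict`).
* In coordinates on a small compact set, a partial derivative of `Ψ ∘ s` is a smooth function of the
  jet of `s`, by the Faà di Bruno formula (`jetComp`), while the jet of `s` depends on `s` in a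
  continuous affine way. So it is enough that `u ↦ Q ∘ u` is smooth for the uniform norm whenever `Q`
  is smooth (`contDiffOn_postComp`).

The differential of left-composition with `f` at `g` is left-composition with `df`: since evaluation
at a point `p` is continuous and linear on tangent vectors, it is enough to compare the velocities of
curves in `N'`, and there the normalization of local additions gives the claim
(`hasDifferentialAt_compLeft`). With differentials identified in this way, the equation
`P' ∘ dT = T ∘ P` on `TE`, applied pointwise on `D`, is the equation for the natural connections.
-/

noncomputable section

namespace MappingSpace

/-! ### Smoothness of maps into closed subspaces -/

section Codomain

variable {E : Type*} [NormedAddCommGroup E] [NormedSpace ℝ E]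
  {F : Type*} [NormedAddCommGroup F] [NormedSpace ℝ F]
  {G : Type*} [NormedAddCommGroup G] [NormedSpace ℝ G]

/-- If a map takes values in a closed subspace, so does its derivative, being a limit of difference
quotients. -/
theorem hasFDerivAt_apply_mem_of_isClosed {R : Submodule ℝ F} (hR : IsClosed (R : Set F))
    {u : Set E} (hu : IsOpen u) {q : E → F} (hq : ∀ y ∈ u, q y ∈ R) {q' : E →L[ℝ] F} {y : E}
    (hy : y ∈ u) (h : HasFDerivAt q q' y) (v : E) : q' v ∈ R := by
  have hl : HasDerivAt (fun t : ℝ => q (y + t • v)) (q' v) 0 := by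
    have h1 : HasDerivAt (fun t : ℝ => y + t • v) v 0 := by
      simpa using ((hasDerivAt_id (0 : ℝ)).smul_const v).const_add y
    exact HasFDerivAt.comp_hasDerivAt (x := (0 : ℝ)) (l := q) (by simpa using h) h1
  have hmem : ∀ᶠ t : ℝ in 𝓝 0, y + t • v ∈ u :=
    ContinuousAt.eventually_mem (by fun_prop) (hu.mem_nhds (by simpa using hy))
  rw [hasDerivAt_iff_tendsto_slope] at hl
  refine hR.mem_of_tendsto hl ?_
  filter_upwards [mem_nhdsWithin_of_mem_nhds hmem] with t ht
  rw [slope_def_module]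
  exact R.smul_mem _ (R.sub_mem (hq _ ht) (hq _ (by simpa using hy)))

/-- A map into a closed subspace is `C^n` as soon as it is so as a map into the ambient space: its
derivatives are limits of difference quotients, so they take values in the subspace. -/
theorem contDiffAt_of_subtype_comp {R : Submodule ℝ F} (hR : IsClosed (R : Set F)) {f : E → R}
    {x : E} {n : ℕ} (h : ContDiffAt ℝ n (fun y => (f y : F)) x) : ContDiffAt ℝ n f x := by
  rw [← contDiffWithinAt_univ, contDiffWithinAt_nat] at h ⊢
  obtain ⟨u₀, hu₀, p, hp₀⟩ := h
  rw [insert_eq_of_mem (mem_univ x), nhdsWithin_univ] at hu₀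
  obtain ⟨u, huu, hu, hxu⟩ := mem_nhds_iff.1 hu₀
  have hp := hp₀.mono huu
  have hder : ∀ m : ℕ, m < n → ∀ y ∈ u,
      HasFDerivAt (fun z => p z m) (p y (m + 1)).curryLeft y := fun m hm y hy =>
    (hp.fderivWithin m (by exact_mod_cast hm) y hy).hasFDerivAt (hu.mem_nhds hy)
  -- by induction on the order, the Taylor series in the ambient space takes values in `R`
  have hmem : ∀ m : ℕ, m ≤ n → ∀ y ∈ u, ∀ v, p y m v ∈ R := by
    intro m
    induction m with
    | zero =>
      intro _ y hy v
      have h0 := hp.zero_eq y hy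
      rw [ContinuousMultilinearMap.curry0_apply] at h0
      rw [Subsingleton.elim v 0]
      erw [h0]
      exact (f y).2
    | succ m ih =>
      intro hm y hy v
      have hd := hder m hm y hy
      have he : HasFDerivAt (fun z => p z m (Fin.tail v))
          ((ContinuousMultilinearMap.apply ℝ (fun _ : Fin m => E) F (Fin.tail v)).comp
            (p y (m + 1)).curryLeft) y :=
        (ContinuousMultilinearMap.apply ℝ (fun _ : Fin m => E) F
          (Fin.tail v)).hasFDerivAt.comp y hd
      have := hasFDerivAt_apply_mem_of_isClosed hR hu
        (fun z hz => ih (Nat.le_of_succ_le hm) z hz (Fin.tail v)) hy he (v 0)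
      simpa using this
  classical
  let r : E → FormalMultilinearSeries ℝ E R := fun y m =>
    if hm : y ∈ u ∧ m ≤ n then (p y m).codRestrict R (hmem m hm.2 y hm.1) else 0
  have hr : ∀ y ∈ u, ∀ m ≤ n, R.subtypeL.compContinuousMultilinearMap (r y m) = p y m := by
    intro y hy m hm
    ext v
    simp [r, hy, hm]
  -- the inclusion of `R` preserves norms of multilinear maps, so that derivatives and continuity of
  -- `p` pass to `r`
  have hiso : ∀ (m : ℕ) (w : E [×m]→L[ℝ] R),
      ‖R.subtypeL.compContinuousMultilinearMap w‖ = ‖w‖ := fun m w =>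
    R.subtypeₗᵢ.norm_compContinuousMultilinearMap w
  have hsub : ∀ (m : ℕ) (w w' : E [×m]→L[ℝ] R), R.subtypeL.compContinuousMultilinearMap (w - w') =
      R.subtypeL.compContinuousMultilinearMap w - R.subtypeL.compContinuousMultilinearMap w' := by
    intro m w w'
    ext v
    simp
  refine ⟨u, by simpa using hu.mem_nhds hxu, r, ?_, ?_, ?_⟩
  · intro y hy
    apply Subtype.ext
    have h0 := hp.zero_eq y hy
    rw [← hr y hy 0 (Nat.zero_le _)] at h0
    exact h0
  · intro m hm y hy
    have hm' : m < n := by exact_mod_cast hm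
    have hd := hder m hm' y hy
    refine HasFDerivAt.hasFDerivWithinAt ?_
    rw [hasFDerivAt_iff_isLittleO] at hd ⊢
    refine (hd.norm_left.congr' ?_ EventuallyEq.rfl).of_norm_left
    filter_upwards [hu.mem_nhds hy] with z hz
    rw [← hiso, hsub, hsub, hr z hz m hm'.le, hr y hy m hm'.le]
    congr 2
    ext v
    have := congrArg (fun w => w (Fin.cons (z - y) v)) (hr y hy (m + 1) hm')
    exact this.symm
  · intro m hm
    have hm' : m ≤ n := by exact_mod_cast hm
    have hc := hp.cont m hm
    intro y hy
    have hcy := hc y hy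
    rw [ContinuousWithinAt, tendsto_iff_norm_sub_tendsto_zero] at hcy ⊢
    refine hcy.congr' ?_
    filter_upwards [self_mem_nhdsWithin] with z hz
    rw [← hiso, hsub, hr z hz m hm', hr y hy m hm']

/-- Smoothness may be tested after a linear embedding `ι` of a Banach space; the bound says that `ι`
is bounded below, so that its range is closed. -/
theorem contDiffAt_of_comp_of_bound [CompleteSpace F] (ι : F →L[ℝ] G) {C : ℝ}
    (hι : ∀ v, ‖v‖ ≤ C * ‖ι v‖) {f : E → F} {x : E}
    (h : ContDiffAt ℝ ∞ (fun y => ι (f y)) x) : ContDiffAt ℝ ∞ f x := by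
  have hanti : AntilipschitzWith (Real.toNNReal C) ι := by
    refine AddMonoidHomClass.antilipschitz_of_bound ι fun v => (hι v).trans ?_
    exact mul_le_mul_of_nonneg_right (Real.le_coe_toNNReal C) (norm_nonneg _)
  have hcl : IsClosed (range ι) := hanti.isClosed_range ι.uniformContinuous
  have hclR : IsClosed ((LinearMap.range (ι : F →ₗ[ℝ] G) : Submodule ℝ G) : Set G) := by
    simpa [LinearMap.coe_range] using hcl
  let e : F ≃L[ℝ] (LinearMap.range (ι : F →ₗ[ℝ] G)) :=
    { LinearEquiv.ofInjective (ι : F →ₗ[ℝ] G) hanti.injective with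
      continuous_toFun := ι.continuous.subtype_mk _
      continuous_invFun := by
        refine AddMonoidHomClass.continuous_of_bound
          (LinearEquiv.ofInjective (ι : F →ₗ[ℝ] G) hanti.injective).symm C fun w => ?_
        obtain ⟨v, rfl⟩ := (LinearEquiv.ofInjective (ι : F →ₗ[ℝ] G) hanti.injective).surjective w
        rw [LinearEquiv.symm_apply_apply]
        exact hι v }
  rw [contDiffAt_infty] at h ⊢
  intro n
  have h1 : ContDiffAt ℝ n (fun y => e (f y)) x := contDiffAt_of_subtype_comp hclR (h n)
  have h2 := e.symm.contDiff.contDiffAt.comp x h1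
  simpa [Function.comp_def] using h2

end Codomain

/-! ### Left-composition for the uniform norm -/

section PostComp

universe u v

variable {K : Type*} [TopologicalSpace K]

/-- The map `u ↦ Q ∘ u` between spaces of continuous functions on a compact space; its value is the
junk value `0` if `Q ∘ u` is not continuous. -/
def postComp {Y : Type*} [TopologicalSpace Y] {Z : Type*} [TopologicalSpace Z] [Zero Z]
    (Q : Y → Z) (u : C(K, Y)) : C(K, Z) :=
  open Classical in if h : Continuous (Q ∘ u) then ⟨Q ∘ u, h⟩ else 0

theorem postComp_apply {Y : Type*} [TopologicalSpace Y] {Z : Type*} [TopologicalSpace Z] [Zero Z]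
    {Q : Y → Z} {O : Set Y} (hQ : ContinuousOn Q O) {u : C(K, Y)} (hu : ∀ x, u x ∈ O) (x : K) :
    postComp Q u x = Q (u x) := by
  rw [postComp, dif_pos (hQ.comp_continuous u.continuous hu)]
  rfl

variable [CompactSpace K]

/-- If a property holds near each diagonal point `(u x, u x)`, then it holds at all `(v x, u x)` as soon
as `v` is uniformly close to `u`. -/
theorem eventually_forall_apply [T2Space K] {Y : Type*} [TopologicalSpace Y] (u : C(K, Y))
    {P : Y × Y → Prop} (h : ∀ x, ∀ᶠ z in 𝓝 (u x, u x), P z) :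
    ∀ᶠ v in 𝓝 u, ∀ x, P (v x, u x) := by
  have := isCompact_univ.eventually_forall_of_forall_eventually (x₀ := u) (K := (univ : Set K))
    (P := fun v x => P (v x, u x)) (fun x _ => by
      have hc : ContinuousAt (fun z : C(K, Y) × K => (z.1 z.2, u z.2)) (u, x) := by fun_prop
      exact hc.eventually (h x))
  simpa using this

theorem isOpen_setOf_forall_mem {Y : Type*} [TopologicalSpace Y] {O : Set Y} (hO : IsOpen O) :
    IsOpen {u : C(K, Y) | ∀ x, u x ∈ O} := by
  simpa [MapsTo] using
    ContinuousMap.isOpen_setOfPred_mapsTo (X := K) isCompact_univ hO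

set_option synthInstance.maxHeartbeats 100000 in
variable (K) in
/-- A continuous family of linear maps acts on continuous functions. -/
def familyApply (Y : Type*) [NormedAddCommGroup Y] [NormedSpace ℝ Y] (Z : Type*)
    [NormedAddCommGroup Z] [NormedSpace ℝ Z] : C(K, Y →L[ℝ] Z) →L[ℝ] C(K, Y) →L[ℝ] C(K, Z) :=
  LinearMap.mkContinuous₂
    (LinearMap.mk₂ ℝ (fun (A : C(K, Y →L[ℝ] Z)) (u : C(K, Y)) =>
      (⟨fun x => A x (u x), by fun_prop⟩ : C(K, Z)))
      (fun _ _ _ => by ext; simp) (fun _ _ _ => by ext; simp)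
      (fun _ _ _ => by ext; simp) (fun _ _ _ => by ext; simp)) 1 (fun A u => by
        rw [one_mul, ContinuousMap.norm_le _ (by positivity)]
        intro x
        exact (A x).le_of_opNorm_le_of_le (A.norm_coe_le_norm x) (u.norm_coe_le_norm x))

set_option synthInstance.maxHeartbeats 100000 in
@[simp]
theorem familyApply_apply {Y : Type*} [NormedAddCommGroup Y] [NormedSpace ℝ Y] {Z : Type*}
    [NormedAddCommGroup Z] [NormedSpace ℝ Z] (A : C(K, Y →L[ℝ] Z)) (u : C(K, Y)) (x : K) :
    familyApply K Y Z A u x = A x (u x) := rfl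

set_option maxHeartbeats 1000000 in
set_option synthInstance.maxHeartbeats 200000 in
theorem contDiff_familyApply {Y : Type*} [NormedAddCommGroup Y] [NormedSpace ℝ Y] {Z : Type*}
    [NormedAddCommGroup Z] [NormedSpace ℝ Z] {n : ℕ∞ω} :
    ContDiff ℝ n (fun A => familyApply K Y Z A) :=
  ContinuousLinearMap.contDiff (E := C(K, Y →L[ℝ] Z)) (F := C(K, Y) →L[ℝ] C(K, Z)) (𝕜 := ℝ)
    (familyApply K Y Z)

variable [T2Space K]

/-- Continuity of `Q` alone suffices here, by compactness of the image of `u`. -/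
theorem continuousOn_postComp {Y : Type*} [NormedAddCommGroup Y] {Z : Type*}
    [NormedAddCommGroup Z] {Q : Y → Z} {O : Set Y} (hO : IsOpen O) (hQ : ContinuousOn Q O) :
    ContinuousOn (postComp (K := K) Q) {u | ∀ x, u x ∈ O} := by
  intro u hu
  refine ContinuousAt.continuousWithinAt ?_
  rw [ContinuousAt, Metric.tendsto_nhds]
  intro ε hε
  have h1 : ∀ x, ∀ᶠ z in 𝓝 (u x, u x), dist (Q z.1) (Q z.2) < ε / 2 := by
    intro x
    have hc := hQ.continuousAt (hO.mem_nhds (hu x))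
    have h2 : ContinuousAt (fun z : Y × Y => dist (Q z.1) (Q z.2)) (u x, u x) :=
      (hc.comp_of_eq continuousAt_fst rfl).dist (hc.comp_of_eq continuousAt_snd rfl)
    exact h2.eventually_lt continuousAt_const (by simpa using half_pos hε)
  filter_upwards [eventually_forall_apply u h1, (isOpen_setOf_forall_mem hO).mem_nhds hu]
    with v hv hv'
  refine lt_of_le_of_lt ((ContinuousMap.dist_le (half_pos hε).le).2 fun x => ?_) (half_lt_self hε)
  rw [postComp_apply hQ hu, postComp_apply hQ hv']
  exact (hv x).le

set_option synthInstance.maxHeartbeats 100000 in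
/-- The derivative of `u ↦ Q ∘ u` at `u` is the pointwise application of `fderiv ℝ Q ∘ u`, which is
again a postcomposition. -/
theorem hasFDerivAt_postComp {Y : Type*} [NormedAddCommGroup Y] [NormedSpace ℝ Y] {Z : Type*}
    [NormedAddCommGroup Z] [NormedSpace ℝ Z] {Q : Y → Z} {O : Set Y} (hO : IsOpen O)
    (hQ : ContDiffOn ℝ 1 Q O) {u : C(K, Y)} (hu : ∀ x, u x ∈ O) :
    HasFDerivAt (postComp Q) (familyApply K Y Z (postComp (fderiv ℝ Q) u)) u := by
  have hQ' : ContinuousOn (fderiv ℝ Q) O := hQ.continuousOn_fderiv_of_isOpen hO le_rfl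
  rw [hasFDerivAt_iff_isLittleO, Asymptotics.isLittleO_iff]
  intro ε hε
  have h1 : ∀ x, ∀ᶠ z in 𝓝 (u x, u x),
      ‖Q z.1 - Q z.2 - fderiv ℝ Q z.2 (z.1 - z.2)‖ ≤ ε * ‖z.1 - z.2‖ := by
    intro x
    have hs : HasStrictFDerivAt Q (fderiv ℝ Q (u x)) (u x) :=
      (hQ.contDiffAt (hO.mem_nhds (hu x))).hasStrictFDerivAt one_ne_zero
    have h2 := (hasStrictFDerivAt_iff_isLittleO.1 hs).def (half_pos hε)
    have h3 : ∀ᶠ z : Y × Y in 𝓝 (u x, u x), ‖fderiv ℝ Q (u x) - fderiv ℝ Q z.2‖ ≤ ε / 2 := by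
      have hc : ContinuousAt (fun z : Y × Y => ‖fderiv ℝ Q (u x) - fderiv ℝ Q z.2‖) (u x, u x) :=
        (continuousAt_const.sub
          ((hQ'.continuousAt (hO.mem_nhds (hu x))).comp_of_eq continuousAt_snd rfl)).norm
      exact (hc.eventually_lt continuousAt_const (by simpa using half_pos hε)).mono
        fun _ h => le_of_lt h
    filter_upwards [h2, h3] with z hz hz'
    calc ‖Q z.1 - Q z.2 - fderiv ℝ Q z.2 (z.1 - z.2)‖
        = ‖(Q z.1 - Q z.2 - fderiv ℝ Q (u x) (z.1 - z.2)) +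
            (fderiv ℝ Q (u x) - fderiv ℝ Q z.2) (z.1 - z.2)‖ := by
          congr 1
          simp
      _ ≤ ε / 2 * ‖z.1 - z.2‖ + ε / 2 * ‖z.1 - z.2‖ :=
          norm_add_le_of_le hz (ContinuousLinearMap.le_of_opNorm_le _ hz' _)
      _ = ε * ‖z.1 - z.2‖ := by ring
  filter_upwards [eventually_forall_apply u h1, (isOpen_setOf_forall_mem hO).mem_nhds hu]
    with v hv hv'
  rw [ContinuousMap.norm_le _ (by positivity)]
  intro x
  rw [ContinuousMap.sub_apply, ContinuousMap.sub_apply, familyApply_apply,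
    postComp_apply hQ.continuousOn hu, postComp_apply hQ.continuousOn hv', postComp_apply hQ' hu]
  exact (hv x).trans (mul_le_mul_of_nonneg_left ((v - u).norm_coe_le_norm x) hε.le)

set_option maxHeartbeats 1000000 in
set_option synthInstance.maxHeartbeats 200000 in
/-- By induction on `n`, since the derivative of `postComp Q` is the composition of
`postComp (fderiv ℝ Q)` with a continuous linear map. -/
theorem contDiffOn_nat_postComp {Y : Type u} [NormedAddCommGroup Y] [NormedSpace ℝ Y]
    {O : Set Y} (hO : IsOpen O) (n : ℕ) : ∀ {Z : Type u} [NormedAddCommGroup Z]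
    [NormedSpace ℝ Z] {Q : Y → Z}, ContDiffOn ℝ n Q O →
      ContDiffOn ℝ n (postComp (K := K) Q) {u | ∀ x, u x ∈ O} := by
  induction n with
  | zero =>
    intro Z _ _ Q hQ
    exact contDiffOn_zero.2 (continuousOn_postComp hO hQ.continuousOn)
  | succ n ih =>
    intro Z _ _ Q hQ
    have hd := fun (w : C(K, Y)) (hw : w ∈ {w : C(K, Y) | ∀ x, w x ∈ O}) =>
      hasFDerivAt_postComp hO (hQ.of_le (by norm_cast; omega)) hw
    push_cast at hQ ⊢
    rw [contDiffOn_succ_iff_fderiv_of_isOpen (isOpen_setOf_forall_mem hO)]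
    refine ⟨fun w hw => (hd w hw).differentiableAt.differentiableWithinAt, by simp, ?_⟩
    rw [contDiffOn_succ_iff_fderiv_of_isOpen hO] at hQ
    have h1 : ContDiffOn ℝ n (fun w => familyApply K Y Z (postComp (fderiv ℝ Q) w))
        {w : C(K, Y) | ∀ x, w x ∈ O} := contDiff_familyApply.comp_contDiffOn (ih hQ.2.2)
    exact h1.congr fun w hw => (hd w hw).fderiv

/-- The smoothness of `u ↦ Q ∘ u` for the uniform norm: if `Q` is smooth on an open set `O`, then so
is this map on the set of all continuous functions with values in `O`. -/
theorem contDiffOn_postComp {Y : Type u} [NormedAddCommGroup Y] [NormedSpace ℝ Y]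
    {Z : Type v} [NormedAddCommGroup Z] [NormedSpace ℝ Z] {Q : Y → Z} {O : Set Y} (hO : IsOpen O)
    (hQ : ContDiffOn ℝ ∞ Q O) : ContDiffOn ℝ ∞ (postComp (K := K) Q) {u | ∀ x, u x ∈ O} := by
  -- The induction on the order replaces `Z` by `Y →L[ℝ] Z`, so both spaces are first lifted to a
  -- common universe.
  let eY : ULift.{v} Y ≃L[ℝ] Y := ContinuousLinearEquiv.ulift
  let eZ : ULift.{u} Z ≃L[ℝ] Z := ContinuousLinearEquiv.ulift
  have hO' : IsOpen (eY ⁻¹' O) := hO.preimage eY.continuous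
  have hQ' : ContDiffOn ℝ ∞ (fun y => eZ.symm (Q (eY y))) (eY ⁻¹' O) :=
    eZ.symm.contDiff.comp_contDiffOn (hQ.comp eY.contDiff.contDiffOn fun _ h => h)
  rw [contDiffOn_infty] at hQ' ⊢
  intro n
  have h1 := contDiffOn_nat_postComp (K := K) hO' n (hQ' n)
  have h2 := (ContinuousLinearMap.compLeftContinuous ℝ K
    (eZ : ULift.{u} Z →L[ℝ] Z)).contDiff.comp_contDiffOn (n := n)
      (h1.comp (ContinuousLinearMap.compLeftContinuous ℝ K
        (eY.symm : Y →L[ℝ] ULift.{v} Y)).contDiff.contDiffOn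
        (s := {u : C(K, Y) | ∀ x, u x ∈ O}) fun w hw x => by simpa using hw x)
  refine h2.congr fun w hw => ?_
  ext x
  have hw' : ∀ x, ContinuousLinearMap.compLeftContinuous ℝ K
        (eY.symm : Y →L[ℝ] ULift.{v} Y) w x ∈ eY ⁻¹' O := fun x => by simpa using hw x
  have h3 := postComp_apply (hQ' 0).continuousOn hw' x
  rw [postComp_apply hQ.continuousOn hw]
  change _ = eZ (postComp _ (ContinuousLinearMap.compLeftContinuous ℝ K
        (eY.symm : Y →L[ℝ] ULift.{v} Y) w) x)
  rw [h3, ContinuousLinearEquiv.apply_symm_apply]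
  change _ = Q (eY (eY.symm (w x)))
  simp

end PostComp

/-! ### Smoothness of maps into spaces of continuous functions is local -/

section Gluing

variable {K : Type*} [TopologicalSpace K] [CompactSpace K]

/-- Restriction of continuous functions to a compact subset, as a continuous linear map. -/
def restrictL (Y : Type*) [NormedAddCommGroup Y] [NormedSpace ℝ Y] (S : Set K) [CompactSpace S] :
    C(K, Y) →L[ℝ] C(S, Y) :=
  LinearMap.mkContinuous
    { toFun := fun u => u.restrict S
      map_add' := fun _ _ => rfl
      map_smul' := fun _ _ => rfl } 1 fun u => by
        rw [one_mul, ContinuousMap.norm_le _ (norm_nonneg _)]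
        exact fun x => u.norm_coe_le_norm x

/-- Smoothness of a map into `C(K, Y)` is local on `K`. -/
theorem contDiffAt_of_restrict {E : Type*} [NormedAddCommGroup E] [NormedSpace ℝ E]
    {Y : Type*} [NormedAddCommGroup Y] [NormedSpace ℝ Y] [CompleteSpace Y] {A : E → C(K, Y)}
    {s : E} (h : ∀ x₀ : K, ∃ S ∈ 𝓝 x₀, ∃ _ : CompactSpace S,
      ContDiffAt ℝ ∞ (fun y => restrictL Y S (A y)) s) : ContDiffAt ℝ ∞ A s := by
  choose S hS hcS hd using h
  obtain ⟨t, -, ht⟩ := isCompact_univ.elim_nhds_subcover S (fun x _ => hS x)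
  let ι : C(K, Y) →L[ℝ] ∀ x : t, C(S x, Y) := ContinuousLinearMap.pi fun x => restrictL Y (S x)
  refine contDiffAt_of_comp_of_bound ι (C := 1) (fun u => ?_) ?_
  · rw [one_mul, ContinuousMap.norm_le _ (norm_nonneg _)]
    intro y
    obtain ⟨x, hx, hy⟩ := mem_iUnion₂.1 (ht (mem_univ y))
    exact ((ι u ⟨x, hx⟩).norm_coe_le_norm ⟨y, hy⟩).trans (norm_le_pi_norm (ι u) ⟨x, hx⟩)
  · exact contDiffAt_pi.2 fun x => hd x

end Gluing

/-! ### Derivatives of functions read in a chart -/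

section ChartDeriv

variable {ED : Type*} [NormedAddCommGroup ED] [NormedSpace ℝ ED]
  {HD : Type*} [TopologicalSpace HD] {I : ModelWithCorners ℝ ED HD}
  {D : Type*} [TopologicalSpace D] [ChartedSpace HD D]
  {Y : Type*} [NormedAddCommGroup Y] [NormedSpace ℝ Y]
  {Z : Type*} [NormedAddCommGroup Z] [NormedSpace ℝ Z] {k : ℕ}

variable (I) in
/-- The `j`-th derivative at `x` of a function on `D`, read in the preferred chart at `c`. -/
def chartDeriv (c : D) (j : ℕ) (q : D → Y) (x : D) : ED [×j]→L[ℝ] Y :=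
  iteratedFDerivWithin ℝ j (q ∘ (extChartAt I c).symm) (range I) (extChartAt I c x)

theorem extChartAt_mem_range (c x : D) : extChartAt I c x ∈ range I := ⟨_, rfl⟩

theorem extChartAt_symm_apply_of_mem {c x : D} (hx : x ∈ (chartAt HD c).source) :
    (extChartAt I c).symm (extChartAt I c x) = x :=
  (extChartAt I c).left_inv (by simpa using hx)

theorem tendsto_extChartAt_symm {c x : D} (hx : x ∈ (chartAt HD c).source) :
    Tendsto (extChartAt I c).symm (𝓝[range I] (extChartAt I c x)) (𝓝 x) := by
  have h := (continuousAt_extChartAt_symm' (I := I) (x := c) (x' := x) (by simpa using hx)).tendsto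
  rw [extChartAt_symm_apply_of_mem hx] at h
  exact h.mono_left nhdsWithin_le_nhds

theorem chartDeriv_congr {c x : D} (hx : x ∈ (chartAt HD c).source) {q q' : D → Y}
    (h : q =ᶠ[𝓝 x] q') (j : ℕ) : chartDeriv I c j q x = chartDeriv I c j q' x := by
  refine Filter.EventuallyEq.iteratedFDerivWithin_eq ?_ ?_ j
  · exact (tendsto_extChartAt_symm hx).eventually h
  · simp only [Function.comp_apply, extChartAt_symm_apply_of_mem hx]
    exact h.self_of_nhds

variable [IsManifold I ∞ D]

theorem contDiffWithinAt_comp_extChartAt_symm {c x : D} (hx : x ∈ (chartAt HD c).source)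
    {q : D → Y} (hq : ContMDiffAt I 𝓘(ℝ, Y) k q x) :
    ContDiffWithinAt ℝ k (q ∘ (extChartAt I c).symm) (range I) (extChartAt I c x) := by
  rw [contMDiffAt_iff_source_of_mem_source hx] at hq
  exact contMDiffWithinAt_iff_contDiffWithinAt.1 hq

theorem continuousAt_chartDeriv {c x : D} (hx : x ∈ (chartAt HD c).source)
    {q : D → Y} (hq : ContMDiffAt I 𝓘(ℝ, Y) k q x) {j : ℕ} (hj : j ≤ k) :
    ContinuousAt (chartDeriv I c j q) x := by
  have h1 := contDiffWithinAt_comp_extChartAt_symm hx hq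
  have h2 := h1.iteratedFDerivWithin_right (m := 0) (i := j) I.uniqueDiffOn
    (by simpa using (by exact_mod_cast hj : (j : ℕ∞ω) ≤ k)) (extChartAt_mem_range c x)
  have h3 : ContinuousAt (extChartAt I c) x := continuousAt_extChartAt' (by simpa using hx)
  exact h2.continuousWithinAt.tendsto.comp (tendsto_nhdsWithin_iff.2
    ⟨h3.tendsto, Eventually.of_forall fun y => extChartAt_mem_range c y⟩)

theorem chartDeriv_add {c x : D} (hx : x ∈ (chartAt HD c).source)
    {q q' : D → Y} (hq : ContMDiffAt I 𝓘(ℝ, Y) k q x) (hq' : ContMDiffAt I 𝓘(ℝ, Y) k q' x)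
    {j : ℕ} (hj : j ≤ k) :
    chartDeriv I c j (fun p => q p + q' p) x = chartDeriv I c j q x + chartDeriv I c j q' x :=
  iteratedFDerivWithin_add_apply
    ((contDiffWithinAt_comp_extChartAt_symm hx hq).of_le (by exact_mod_cast hj))
    ((contDiffWithinAt_comp_extChartAt_symm hx hq').of_le (by exact_mod_cast hj))
    I.uniqueDiffOn (extChartAt_mem_range c x)

theorem chartDeriv_const_smul {c x : D} (hx : x ∈ (chartAt HD c).source)
    {q : D → Y} (hq : ContMDiffAt I 𝓘(ℝ, Y) k q x) {j : ℕ} (hj : j ≤ k) (a : ℝ) :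
    chartDeriv I c j (fun p => a • q p) x = a • chartDeriv I c j q x :=
  iteratedFDerivWithin_const_smul_apply
    ((contDiffWithinAt_comp_extChartAt_symm hx hq).of_le (by exact_mod_cast hj))
    I.uniqueDiffOn (extChartAt_mem_range c x)

theorem chartDeriv_clm_comp {c x : D} (hx : x ∈ (chartAt HD c).source)
    {q : D → Y} (hq : ContMDiffAt I 𝓘(ℝ, Y) k q x) {j : ℕ} (hj : j ≤ k) (L : Y →L[ℝ] Z) :
    chartDeriv I c j (fun p => L (q p)) x =
      L.compContinuousMultilinearMap (chartDeriv I c j q x) :=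
  L.iteratedFDerivWithin_comp_left (contDiffWithinAt_comp_extChartAt_symm hx hq)
    I.uniqueDiffOn (extChartAt_mem_range c x) (by exact_mod_cast hj)

/-- The Faà di Bruno formula for derivatives read in a chart. -/
theorem chartDeriv_comp {c x : D} (hx : x ∈ (chartAt HD c).source)
    {q : D → Y} (hq : ContMDiffAt I 𝓘(ℝ, Y) k q x) {G : Y → Z} {t : Set Y}
    (ht : UniqueDiffOn ℝ t) (hqt : ∀ p, q p ∈ t) (hG : ContDiffWithinAt ℝ k G t (q x))
    {j : ℕ} (hj : j ≤ k) :
    chartDeriv I c j (G ∘ q) x =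
      (ftaylorSeriesWithin ℝ G t (q x)).taylorComp (fun i => chartDeriv I c i q x) j := by
  have hx' : (q ∘ (extChartAt I c).symm) (extChartAt I c x) = q x := by
    rw [Function.comp_apply, extChartAt_symm_apply_of_mem hx]
  have h := iteratedFDerivWithin_comp (g := G) (t := t) (by rwa [hx'])
    (contDiffWithinAt_comp_extChartAt_symm hx hq) ht I.uniqueDiffOn (extChartAt_mem_range c x)
    (fun _ _ => hqt _) (i := j) (by exact_mod_cast hj)
  rw [hx'] at h
  exact h

/-- The effect of a change of charts on derivatives. -/
theorem chartDeriv_change {c c' x : D} (hx : x ∈ (chartAt HD c).source)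
    (hx' : x ∈ (chartAt HD c').source) {q : D → Y} (hq : ContMDiffAt I 𝓘(ℝ, Y) k q x)
    {j : ℕ} (hj : j ≤ k) :
    chartDeriv I c' j q x = FormalMultilinearSeries.taylorComp (fun i => chartDeriv I c i q x)
      (fun i => chartDeriv I c' i (extChartAt I c) x) j := by
  have h := chartDeriv_comp hx' (contMDiffAt_extChartAt' hx) I.uniqueDiffOn
    (fun p => extChartAt_mem_range c p) (contDiffWithinAt_comp_extChartAt_symm hx hq) hj
  rw [← chartDeriv_congr hx' ?_ j] at h
  · exact h
  · filter_upwards [(chartAt HD c).open_source.mem_nhds hx] with y hy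
    simp only [Function.comp_apply, extChartAt_symm_apply_of_mem hy]

theorem norm_chartDeriv_clm_apply_le {c x : D} (hx : x ∈ (chartAt HD c).source)
    {A : D → Y →L[ℝ] Z} (hA : ContMDiffAt I 𝓘(ℝ, Y →L[ℝ] Z) k A x)
    {q : D → Y} (hq : ContMDiffAt I 𝓘(ℝ, Y) k q x) {j : ℕ} (hj : j ≤ k) {a b : ℝ}
    (ha : ∀ i ≤ j, ‖chartDeriv I c i A x‖ ≤ a) (hb : ∀ i ≤ j, ‖chartDeriv I c i q x‖ ≤ b) :
    ‖chartDeriv I c j (fun p => A p (q p)) x‖ ≤ 2 ^ j * (a * b) := by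
  obtain ⟨u, hu, hxu, hAu⟩ := (contDiffWithinAt_comp_extChartAt_symm hx hA).contDiffOn'
    (m := k) le_rfl (by simp)
  obtain ⟨v, hv, hxv, hqv⟩ := (contDiffWithinAt_comp_extChartAt_symm hx hq).contDiffOn'
    (m := k) le_rfl (by simp)
  rw [insert_eq_of_mem (extChartAt_mem_range c x)] at hAu hqv
  have huv := hu.inter hv
  have hxuv : extChartAt I c x ∈ u ∩ v := ⟨hxu, hxv⟩
  have h := (ContinuousLinearMap.id ℝ (Y →L[ℝ] Z)).norm_iteratedFDerivWithin_le_of_bilinear_of_le_one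
    (hAu.mono (inter_subset_inter_right _ inter_subset_left))
    (hqv.mono (inter_subset_inter_right _ inter_subset_right))
    (I.uniqueDiffOn.inter huv) ⟨extChartAt_mem_range c x, hxuv⟩ (n := j) (by exact_mod_cast hj)
    ContinuousLinearMap.norm_id_le
  simp_rw [iteratedFDerivWithin_inter_open huv hxuv] at h
  refine h.trans ?_
  have ha0 : 0 ≤ a := (norm_nonneg _).trans (ha 0 (Nat.zero_le _))
  calc _ ≤ ∑ i ∈ Finset.range (j + 1), (j.choose i : ℝ) * (a * b) := by
        refine Finset.sum_le_sum fun i hi => ?_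
        rw [mul_assoc]
        have hi' : i ≤ j := Nat.lt_succ_iff.1 (Finset.mem_range.1 hi)
        exact mul_le_mul_of_nonneg_left (mul_le_mul (ha i hi') (hb (j - i) (Nat.sub_le _ _))
          (norm_nonneg _) ha0) (by positivity)
    _ = 2 ^ j * (a * b) := by
        rw [← Finset.sum_mul]
        congr 1
        exact_mod_cast Nat.sum_range_choose j

/-- A crude bound for the Faà di Bruno formula. -/
theorem norm_taylorComp_le {X : Type*} [NormedAddCommGroup X] [NormedSpace ℝ X]
    (q : FormalMultilinearSeries ℝ Y Z) (p : FormalMultilinearSeries ℝ X Y) {j : ℕ} {a b : ℝ}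
    (hb : 1 ≤ b) (hq : ∀ i ≤ j, ‖q i‖ ≤ a) (hp : ∀ i ≤ j, ‖p i‖ ≤ b) :
    ‖q.taylorComp p j‖ ≤ Fintype.card (OrderedFinpartition j) * (b ^ j * a) := by
  have ha0 : 0 ≤ a := (norm_nonneg _).trans (hq 0 (Nat.zero_le _))
  refine (norm_sum_le _ _).trans ?_
  rw [← nsmul_eq_mul, ← Finset.card_univ]
  refine Finset.sum_le_card_nsmul _ _ _ fun c _ => ?_
  refine (c.norm_compAlongOrderedFinpartition_le _ _).trans ?_
  rw [mul_comm (b ^ j)]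
  refine mul_le_mul (hq _ c.length_le) ?_ (by positivity) ha0
  calc ∏ m, ‖p (c.partSize m)‖ ≤ ∏ _m : Fin c.length, b :=
        Finset.prod_le_prod (fun _ _ => norm_nonneg _) fun m _ => hp _ (c.partSize_le m)
    _ = b ^ c.length := by simp
    _ ≤ b ^ j := pow_le_pow_right₀ hb c.length_le

theorem exists_eventually_norm_chartDeriv_le {c x : D} (hx : x ∈ (chartAt HD c).source)
    {q : D → Y} (hq : ContMDiffAt I 𝓘(ℝ, Y) k q x) :
    ∃ b : ℝ, 1 ≤ b ∧ ∀ᶠ y in 𝓝 x, ∀ i ≤ k, ‖chartDeriv I c i q y‖ ≤ b := by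
  have hc : ContinuousAt (fun y => ∑ i ∈ Finset.range (k + 1), ‖chartDeriv I c i q y‖) x :=
    tendsto_finsetSum _ fun i hi =>
      (continuousAt_chartDeriv hx hq (Nat.lt_succ_iff.1 (Finset.mem_range.1 hi))).norm
  refine ⟨∑ i ∈ Finset.range (k + 1), ‖chartDeriv I c i q x‖ + 1, ?_, ?_⟩
  · have : 0 ≤ ∑ i ∈ Finset.range (k + 1), ‖chartDeriv I c i q x‖ :=
      Finset.sum_nonneg fun _ _ => norm_nonneg _
    linarith
  · filter_upwards [hc.eventually_lt continuousAt_const (lt_add_one _)] with y hy i hi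
    exact (Finset.single_le_sum (f := fun i => ‖chartDeriv I c i q y‖)
      (fun _ _ => norm_nonneg _) (Finset.mem_range.2 (Nat.lt_succ_iff.2 hi))).trans hy.le

/-- The derivatives of `p ↦ A p (q p)` in one chart are bounded by those of `q` in another chart. -/
theorem exists_norm_chartDeriv_change_le {c c' x₀ : D} (hx : x₀ ∈ (chartAt HD c).source)
    (hx' : x₀ ∈ (chartAt HD c').source) {A : D → Y →L[ℝ] Z}
    (hA : ∀ᶠ x in 𝓝 x₀, ContMDiffAt I 𝓘(ℝ, Y →L[ℝ] Z) k A x) :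
    ∃ C : ℝ, 0 ≤ C ∧ ∀ᶠ x in 𝓝 x₀, ∀ q : D → Y, ContMDiffAt I 𝓘(ℝ, Y) k q x → ∀ b : ℝ,
      (∀ i ≤ k, ‖chartDeriv I c i q x‖ ≤ b) →
        ∀ j ≤ k, ‖chartDeriv I c' j (fun p => A p (q p)) x‖ ≤ C * b := by
  obtain ⟨a, ha1, ha⟩ := exists_eventually_norm_chartDeriv_le hx' hA.self_of_nhds
  obtain ⟨r, hr1, hr⟩ := exists_eventually_norm_chartDeriv_le (k := k) hx'
    (contMDiffAt_extChartAt' (I := I) hx)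
  let N : ℝ := ∑ i ∈ Finset.range (k + 1), (Fintype.card (OrderedFinpartition i) : ℝ)
  have hN : ∀ i ≤ k, (Fintype.card (OrderedFinpartition i) : ℝ) ≤ N := fun i hi =>
    Finset.single_le_sum (f := fun i => (Fintype.card (OrderedFinpartition i) : ℝ))
      (fun _ _ => by positivity) (Finset.mem_range.2 (Nat.lt_succ_iff.2 hi))
  have hN0 : 0 ≤ N := Finset.sum_nonneg fun _ _ => by positivity
  refine ⟨2 ^ k * (a * (N * r ^ k)), by positivity, ?_⟩
  filter_upwards [hA, ha, hr, (chartAt HD c).open_source.mem_nhds hx,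
    (chartAt HD c').open_source.mem_nhds hx'] with x hAx hax hrx hxc hxc' q hq b hb j hj
  have hb0 : 0 ≤ b := (norm_nonneg _).trans (hb 0 (Nat.zero_le _))
  have h1 : ∀ i ≤ k, ‖chartDeriv I c' i q x‖ ≤ N * (r ^ k * b) := by
    intro i hi
    rw [chartDeriv_change hxc hxc' hq hi]
    refine (norm_taylorComp_le _ _ hr1 (fun l hl => hb l (hl.trans hi))
      (fun l hl => hrx l (hl.trans hi))).trans ?_
    exact mul_le_mul (hN i hi) (mul_le_mul_of_nonneg_right (pow_le_pow_right₀ hr1 hi) hb0)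
      (by positivity) hN0
  have h2 := norm_chartDeriv_clm_apply_le hxc' hAx hq hj (fun i hi => hax i (hi.trans hj))
    (fun i hi => h1 i (hi.trans hj))
  refine h2.trans ?_
  calc _ ≤ 2 ^ k * (a * (N * (r ^ k * b))) :=
        mul_le_mul_of_nonneg_right (pow_le_pow_right₀ one_le_two hj) (by positivity)
    _ = _ := by ring

end ChartDeriv

/-! ### The `C^k` norm and arbitrary charts -/

section Sections

variable {ED : Type*} [NormedAddCommGroup ED] [NormedSpace ℝ ED]
  {HD : Type*} [TopologicalSpace HD] {I : ModelWithCorners ℝ ED HD}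
  {D : Type*} [TopologicalSpace D] [ChartedSpace HD D]
  {F : Type*} [NormedAddCommGroup F] [NormedSpace ℝ F]
  {W : D → Type*} [TopologicalSpace (TotalSpace F W)]
  [∀ x, TopologicalSpace (W x)] [FiberBundle F W]
  [∀ x, AddCommGroup (W x)] [∀ x, Module ℝ (W x)] [VectorBundle ℝ F W] {k : ℕ}

/-- The fibre coordinate of a section in the preferred trivialization at `b`. -/
def coord (b : D) (s : Cₛ^k⟮I; F, W⟯) (p : D) : F :=
  (trivializationAt F W b).continuousLinearMapAt ℝ p (s p)

theorem coord_apply {b p : D} (s : Cₛ^k⟮I; F, W⟯) (hp : p ∈ (trivializationAt F W b).baseSet) :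
    coord b s p = (trivializationAt F W b ⟨p, s p⟩).2 := by
  rw [coord, Trivialization.continuousLinearMapAt_apply, Trivialization.coe_linearMapAt_of_mem _ hp]

theorem coord_add (b : D) (s t : Cₛ^k⟮I; F, W⟯) :
    coord b (s + t) = fun p => coord b s p + coord b t p :=
  funext fun _ => map_add _ _ _

theorem coord_smul (b : D) (a : ℝ) (s : Cₛ^k⟮I; F, W⟯) :
    coord b (a • s) = fun p => a • coord b s p :=
  funext fun _ => map_smul _ _ _

theorem symmL_coord {b p : D} (s : Cₛ^k⟮I; F, W⟯) (hp : p ∈ (trivializationAt F W b).baseSet) :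
    (trivializationAt F W b).symmL ℝ p (coord b s p) = s p :=
  Trivialization.symmL_continuousLinearMapAt _ hp _

theorem coord_change {b d p : D} (s : Cₛ^k⟮I; F, W⟯)
    (hb : p ∈ (trivializationAt F W b).baseSet) (hd : p ∈ (trivializationAt F W d).baseSet) :
    coord b s p = (trivializationAt F W d).coordChangeL ℝ (trivializationAt F W b) p
      (coord d s p) := by
  rw [Trivialization.coordChangeL_apply _ _ ⟨hd, hb⟩, coord_apply s hb]
  have := symmL_coord s hd
  rw [Trivialization.symmL_apply] at this
  · rw [this]
  · exact hd

variable [ContMDiffVectorBundle k F W I]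

theorem contMDiffAt_coord {b p : D} (s : Cₛ^k⟮I; F, W⟯)
    (hp : p ∈ (trivializationAt F W b).baseSet) : ContMDiffAt I 𝓘(ℝ, F) k (coord b s) p := by
  have h1 := ((trivializationAt F W b).contMDiffAt_section_iff hp).1 (s.contMDiff p)
  refine h1.congr_of_eventuallyEq ?_
  filter_upwards [(trivializationAt F W b).open_baseSet.mem_nhds hp] with y hy
  exact coord_apply s hy

variable [CompactSpace D] [T2Space D] [IsManifold I ∞ D]

theorem norm_chartDeriv_coord_le {c x : D} (hc : c ∈ (compactCover HD F W).centers)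
    (hx : x ∈ (compactCover HD F W).piece c) (s : Cₛ^k⟮I; F, W⟯) {j : ℕ} (hj : j ≤ k) :
    ‖chartDeriv I c j (coord c s) x‖ ≤ ‖s‖ := by
  let J : JetSpace ED HD F W k := jetMap I F W k s
  have h1 : ‖J ⟨c, hc⟩ ⟨j, Nat.lt_succ_iff.2 hj⟩ ⟨x, hx⟩‖ ≤ ‖J‖ :=
    (ContinuousMap.norm_coe_le_norm _ _).trans ((norm_le_pi_norm (J ⟨c, hc⟩) _).trans
      (norm_le_pi_norm J ⟨c, hc⟩))
  exact h1

theorem norm_le_of_norm_chartDeriv_coord_le {s : Cₛ^k⟮I; F, W⟯} {b : ℝ} (hb : 0 ≤ b)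
    (h : ∀ c ∈ (compactCover HD F W).centers, ∀ x ∈ (compactCover HD F W).piece c, ∀ j ≤ k,
      ‖chartDeriv I c j (coord c s) x‖ ≤ b) : ‖s‖ ≤ b := by
  change ‖(jetMap I F W k s : JetSpace ED HD F W k)‖ ≤ b
  refine (pi_norm_le_iff_of_nonneg hb).2 fun c => (pi_norm_le_iff_of_nonneg hb).2 fun j =>
    (ContinuousMap.norm_le _ hb).2 fun x => ?_
  exact h c c.2 x x.2 j (Nat.lt_succ_iff.1 j.2)

variable (I F W k) in
/-- The `C^k` norm controls the derivatives of sections in all charts of `D` and trivializations of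
`W`, and not only in those used in its definition. -/
theorem exists_norm_chartDeriv_coord_le {c b x₀ : D} (hc : x₀ ∈ (chartAt HD c).source)
    (hb : x₀ ∈ (trivializationAt F W b).baseSet) :
    ∃ C : ℝ, 0 ≤ C ∧ ∀ᶠ x in 𝓝 x₀, ∀ s : Cₛ^k⟮I; F, W⟯, ∀ j ≤ k,
      ‖chartDeriv I c j (coord b s) x‖ ≤ C * ‖s‖ := by
  classical
  -- Each compact set `d` of the cover is treated separately: if `x₀` lies outside it, so do all
  -- points near `x₀`; otherwise the change of charts and trivializations applies.
  have hd : ∀ d : D, ∃ C : ℝ, 0 ≤ C ∧ ∀ᶠ x in 𝓝 x₀, x ∈ (compactCover HD F W).piece d →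
      d ∈ (compactCover HD F W).centers → ∀ s : Cₛ^k⟮I; F, W⟯, ∀ j ≤ k,
        ‖chartDeriv I c j (coord b s) x‖ ≤ C * ‖s‖ := by
    intro d
    by_cases hxd : x₀ ∈ (compactCover HD F W).piece d
    · have hs := (compactCover HD F W).piece_subset_chart d hxd
      have ht := (compactCover HD F W).piece_subset_triv d hxd
      have hA : ∀ᶠ x in 𝓝 x₀, ContMDiffAt I 𝓘(ℝ, F →L[ℝ] F) k (fun p =>
          ((trivializationAt F W d).coordChangeL ℝ (trivializationAt F W b) p : F →L[ℝ] F)) x := by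
        filter_upwards [(trivializationAt F W b).open_baseSet.mem_nhds hb,
          (trivializationAt F W d).open_baseSet.mem_nhds ht] with x hxb hxd
        exact contMDiffAt_coordChangeL hxd hxb
      obtain ⟨C, hC0, hC⟩ := exists_norm_chartDeriv_change_le hs hc hA
      refine ⟨C, hC0, ?_⟩
      filter_upwards [hC, (trivializationAt F W b).open_baseSet.mem_nhds hb,
          (trivializationAt F W d).open_baseSet.mem_nhds ht,
          (chartAt HD c).open_source.mem_nhds hc] with x hCx hxb hxd hxc hxK hdc s j hj
      rw [chartDeriv_congr hxc (q' := fun p =>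
        ((trivializationAt F W d).coordChangeL ℝ (trivializationAt F W b) p : F →L[ℝ] F)
          (coord d s p)) ?_ j]
      · exact hCx (coord d s) (contMDiffAt_coord s hxd) ‖s‖
          (fun i hi => norm_chartDeriv_coord_le hdc hxK s hi) j hj
      · filter_upwards [(trivializationAt F W b).open_baseSet.mem_nhds hxb,
          (trivializationAt F W d).open_baseSet.mem_nhds hxd] with y hyb hyd
        exact coord_change s hyb hyd
    · refine ⟨0, le_rfl, ?_⟩
      filter_upwards [((compactCover HD F W).isCompact_piece d).isClosed.isOpen_compl.mem_nhds hxd]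
        with x hx hx'
      exact absurd hx' hx
  choose C hC0 hC using hd
  refine ⟨∑ d ∈ (compactCover HD F W).centers, C d, Finset.sum_nonneg fun d _ => hC0 d, ?_⟩
  have hall := (Finset.eventually_all (compactCover HD F W).centers).2 fun d _ => hC d
  filter_upwards [hall] with x hx s j hj
  obtain ⟨d, hd, hxd⟩ := (compactCover HD F W).covers x
  refine (hx d hd hxd hd s j hj).trans (mul_le_mul_of_nonneg_right ?_ (norm_nonneg _))
  exact Finset.single_le_sum (f := C) (fun i _ => hC0 i) hd

end Sections

/-! ### Uniform limits of Taylor series -/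

section UniformLimits

variable {E : Type*} [NormedAddCommGroup E] [NormedSpace ℝ E]
  {Y : Type*} [NormedAddCommGroup Y] [NormedSpace ℝ Y]

/-- On a convex set, which need not be open, derivatives pass to uniform limits. -/
theorem hasFDerivWithinAt_of_tendstoUniformlyOn_convex {s : Set E} (hs : Convex ℝ s)
    {u : ℕ → E → Y} {u' : ℕ → E → E →L[ℝ] Y} {v : E → Y} {v' : E → E →L[ℝ] Y}
    (hu : ∀ n, ∀ x ∈ s, HasFDerivWithinAt (u n) (u' n x) s x)
    (hv' : TendstoUniformlyOn u' v' atTop s)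
    (hv : ∀ x ∈ s, Tendsto (fun n => u n x) atTop (𝓝 (v x))) {x : E} (hx : x ∈ s) :
    HasFDerivWithinAt v (v' x) s x := by
  rw [hasFDerivWithinAt_iff_isLittleO, Asymptotics.isLittleO_iff]
  intro ε hε
  have hε4 : 0 < ε / 4 := by positivity
  obtain ⟨N, hN⟩ := eventually_atTop.1 (Metric.tendstoUniformlyOn_iff.1 hv' (ε / 4) hε4)
  have h1 : ∀ y ∈ s, ‖(v y - u N y) - (v x - u N x)‖ ≤ 2 * (ε / 4) * ‖y - x‖ := by
    intro y hy
    have hlim : Tendsto (fun m => ‖(u m y - u N y) - (u m x - u N x)‖) atTop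
        (𝓝 ‖(v y - u N y) - (v x - u N x)‖) :=
      (((hv y hy).sub_const _).sub ((hv x hx).sub_const _)).norm
    refine le_of_tendsto hlim ?_
    filter_upwards [eventually_ge_atTop N] with m hm
    refine hs.norm_image_sub_le_of_norm_hasFDerivWithin_le (f := fun z => u m z - u N z)
      (f' := fun z => u' m z - u' N z) (fun z hz => (hu m z hz).sub (hu N z hz))
      (fun z hz => ?_) hx hy
    have h2 := hN m hm z hz
    have h3 := hN N le_rfl z hz
    rw [← dist_eq_norm]
    refine (dist_triangle_left _ _ (v' z)).trans ?_
    linarith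
  have h4 := (hasFDerivWithinAt_iff_isLittleO.1 (hu N x hx)).def hε4
  filter_upwards [h4, self_mem_nhdsWithin] with y hy hys
  have h5 : ‖u' N x - v' x‖ ≤ ε / 4 := by
    rw [← dist_eq_norm, dist_comm]
    exact (hN N le_rfl x hx).le
  calc ‖v y - v x - v' x (y - x)‖
      = ‖((v y - u N y) - (v x - u N x)) + (u N y - u N x - u' N x (y - x)) +
          (u' N x - v' x) (y - x)‖ := by
        congr 1
        simp only [sub_apply]
        abel
    _ ≤ 2 * (ε / 4) * ‖y - x‖ + ε / 4 * ‖y - x‖ + ε / 4 * ‖y - x‖ :=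
        norm_add_le_of_le (norm_add_le_of_le (h1 y hys) hy)
          (ContinuousLinearMap.le_of_opNorm_le _ h5 _)
    _ = ε * ‖y - x‖ := by ring

/-- Taylor series up to order `k` on a convex set pass to uniform limits. -/
theorem hasFTaylorSeriesUpToOn_of_tendstoUniformlyOn {s : Set E} (hs : Convex ℝ s) {k : ℕ}
    {u : ℕ → E → Y} {p : ℕ → E → FormalMultilinearSeries ℝ E Y}
    {q : E → FormalMultilinearSeries ℝ E Y}
    (hp : ∀ n, HasFTaylorSeriesUpToOn k (u n) (p n) s)
    (hq : ∀ j ≤ k, TendstoUniformlyOn (fun n x => p n x j) (fun x => q x j) atTop s) :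
    HasFTaylorSeriesUpToOn k (fun x => (q x 0).curry0) q s where
  zero_eq _ _ := rfl
  fderivWithin m hm x hx := by
    have hm' : m < k := by exact_mod_cast hm
    refine hasFDerivWithinAt_of_tendstoUniformlyOn_convex hs
      (u' := fun n y => (p n y (m + 1)).curryLeft) (v' := fun y => (q y (m + 1)).curryLeft)
      (fun n x hx => (hp n).fderivWithin m hm x hx) ?_
      (fun y hy => (hq m hm'.le).tendsto_at hy) hx
    exact (continuousMultilinearCurryLeftEquiv ℝ (fun _ : Fin (m + 1) => E)
      Y).isometry.uniformContinuous.comp_tendstoUniformlyOn (hq (m + 1) hm')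
  cont m hm := (hq m (by exact_mod_cast hm)).continuousOn
    (Eventually.frequently (Eventually.of_forall fun n => (hp n).cont m hm))

end UniformLimits

/-! ### Completeness of the space of `C^k` sections -/

section Completeness

variable {ED : Type*} [NormedAddCommGroup ED] [NormedSpace ℝ ED]
  {HD : Type*} [TopologicalSpace HD] {I : ModelWithCorners ℝ ED HD}
  {D : Type*} [TopologicalSpace D] [ChartedSpace HD D]
  {F : Type*} [NormedAddCommGroup F] [NormedSpace ℝ F]
  {W : D → Type*} [TopologicalSpace (TotalSpace F W)]
  [∀ x, TopologicalSpace (W x)] [FiberBundle F W]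
  [∀ x, AddCommGroup (W x)] [∀ x, Module ℝ (W x)] [VectorBundle ℝ F W] {k : ℕ}
  [ContMDiffVectorBundle k F W I] [IsManifold I ∞ D]

theorem chartDeriv_coord_add {b c x : D} (hc : x ∈ (chartAt HD c).source)
    (hb : x ∈ (trivializationAt F W b).baseSet) (s t : Cₛ^k⟮I; F, W⟯) {j : ℕ} (hj : j ≤ k) :
    chartDeriv I c j (coord b (s + t)) x =
      chartDeriv I c j (coord b s) x + chartDeriv I c j (coord b t) x := by
  rw [coord_add]
  exact chartDeriv_add hc (contMDiffAt_coord s hb) (contMDiffAt_coord t hb) hj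

theorem chartDeriv_coord_smul {b c x : D} (hc : x ∈ (chartAt HD c).source)
    (hb : x ∈ (trivializationAt F W b).baseSet) (a : ℝ) (s : Cₛ^k⟮I; F, W⟯) {j : ℕ} (hj : j ≤ k) :
    chartDeriv I c j (coord b (a • s)) x = a • chartDeriv I c j (coord b s) x := by
  rw [coord_smul]
  exact chartDeriv_const_smul hc (contMDiffAt_coord s hb) hj a

theorem chartDeriv_coord_sub {b c x : D} (hc : x ∈ (chartAt HD c).source)
    (hb : x ∈ (trivializationAt F W b).baseSet) (s t : Cₛ^k⟮I; F, W⟯) {j : ℕ} (hj : j ≤ k) :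
    chartDeriv I c j (coord b (s - t)) x =
      chartDeriv I c j (coord b s) x - chartDeriv I c j (coord b t) x := by
  have h : s - t = s + (-1 : ℝ) • t := by rw [neg_one_smul, sub_eq_add_neg]
  rw [h, chartDeriv_coord_add hc hb _ _ hj, chartDeriv_coord_smul hc hb _ _ hj, neg_one_smul,
    sub_eq_add_neg]

variable [CompactSpace D] [T2Space D]

variable (I F W k) in
/-- The case of order `0` of `exists_norm_chartDeriv_coord_le`. -/
theorem exists_eventually_norm_coord_le {b x : D} (hb : x ∈ (trivializationAt F W b).baseSet) :
    ∃ C : ℝ, 0 ≤ C ∧ ∀ᶠ y in 𝓝 x, ∀ s : Cₛ^k⟮I; F, W⟯, ‖coord b s y‖ ≤ C * ‖s‖ := by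
  obtain ⟨C, hC0, hC⟩ := exists_norm_chartDeriv_coord_le I F W k (mem_chart_source HD x) hb
  refine ⟨C, hC0, ?_⟩
  filter_upwards [hC, (chartAt HD x).open_source.mem_nhds (mem_chart_source HD x)] with y hy hyx s
  have h := hy s 0 (Nat.zero_le _)
  rwa [chartDeriv, norm_iteratedFDerivWithin_zero, Function.comp_apply,
    extChartAt_symm_apply_of_mem hyx] at h

variable (I k) in
/-- The fibre coordinate at the point `x` of sections, in the preferred trivialization at `b`, as a
continuous linear map. -/
def coordL {b x : D} (hb : x ∈ (trivializationAt F W b).baseSet) : Cₛ^k⟮I; F, W⟯ →L[ℝ] F :=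
  LinearMap.mkContinuousOfExistsBound
    { toFun := fun s => coord b s x
      map_add' := fun s t => congrFun (coord_add b s t) x
      map_smul' := fun a s => congrFun (coord_smul b a s) x }
    (let ⟨C, _, hC⟩ := exists_eventually_norm_coord_le I F W k hb; ⟨C, hC.self_of_nhds⟩)

/-- If the coordinates of a Cauchy sequence of sections converge pointwise, then the limit is `C^k`
and the derivatives converge as well. -/
theorem contMDiffAt_of_cauchySeq [CompleteSpace F] {s : ℕ → Cₛ^k⟮I; F, W⟯} (hs : CauchySeq s)
    {b c x₀ : D} (hc : x₀ ∈ (chartAt HD c).source) (hb : x₀ ∈ (trivializationAt F W b).baseSet)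
    {q : D → F} (hq : ∀ p ∈ (trivializationAt F W b).baseSet,
      Tendsto (fun n => coord b (s n) p) atTop (𝓝 (q p))) :
    ContMDiffAt I 𝓘(ℝ, F) k q x₀ ∧ ∀ j ≤ k,
      Tendsto (fun n => chartDeriv I c j (coord b (s n)) x₀) atTop
        (𝓝 (chartDeriv I c j q x₀)) := by
  obtain ⟨C, hC0, hC⟩ := exists_norm_chartDeriv_coord_le I F W k hc hb
  have hev : ∀ᶠ y in 𝓝[range I] (extChartAt I c x₀), y ∈ (extChartAt I c).target ∧
      (extChartAt I c).symm y ∈ (trivializationAt F W b).baseSet ∧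
      ∀ s : Cₛ^k⟮I; F, W⟯, ∀ j ≤ k,
        ‖chartDeriv I c j (coord b s) ((extChartAt I c).symm y)‖ ≤ C * ‖s‖ := by
    refine Filter.Eventually.and (extChartAt_target_mem_nhdsWithin' (by simpa using hc)) ?_
    exact (tendsto_extChartAt_symm hc).eventually
      (Filter.Eventually.and ((trivializationAt F W b).open_baseSet.mem_nhds hb) hC)
  obtain ⟨r, hr, hball⟩ := Metric.mem_nhdsWithin_iff.1 hev
  -- The set `O` is convex, as needed for the limit of the derivatives: the range of a model with
  -- corners is convex.
  let O : Set ED := range I ∩ Metric.ball (extChartAt I c x₀) r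
  have hO : ∀ y ∈ O, y ∈ (extChartAt I c).target ∧
      (extChartAt I c).symm y ∈ (trivializationAt F W b).baseSet ∧
      ∀ s : Cₛ^k⟮I; F, W⟯, ∀ j ≤ k,
        ‖chartDeriv I c j (coord b s) ((extChartAt I c).symm y)‖ ≤ C * ‖s‖ :=
    fun y hy => hball ⟨hy.2, hy.1⟩
  have hOc : Convex ℝ O := I.convex_range.inter (convex_ball _ _)
  have hOu : UniqueDiffOn ℝ O := I.uniqueDiffOn.inter Metric.isOpen_ball
  have hx₀O : extChartAt I c x₀ ∈ O := ⟨extChartAt_mem_range c x₀, Metric.mem_ball_self hr⟩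
  have hsrc : ∀ y ∈ O, (extChartAt I c).symm y ∈ (chartAt HD c).source := fun y hy => by
    simpa using (extChartAt I c).map_target (hO y hy).1
  have hinv : ∀ y ∈ O, extChartAt I c ((extChartAt I c).symm y) = y := fun y hy =>
    (extChartAt I c).right_inv (hO y hy).1
  let u : ℕ → ED → F := fun n => coord b (s n) ∘ (extChartAt I c).symm
  have hD : ∀ n j, ∀ y ∈ O, iteratedFDerivWithin ℝ j (u n) O y =
      chartDeriv I c j (coord b (s n)) ((extChartAt I c).symm y) := by
    intro n j y hy
    rw [chartDeriv, hinv y hy]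
    exact iteratedFDerivWithin_inter_open Metric.isOpen_ball hy.2
  have hsm : ∀ n, ContDiffOn ℝ k (u n) O := by
    intro n y hy
    have h := contDiffWithinAt_comp_extChartAt_symm (hsrc y hy)
      (contMDiffAt_coord (s n) (hO y hy).2.1)
    rw [hinv y hy] at h
    exact h.mono inter_subset_left
  have hcau : ∀ j ≤ k, UniformCauchySeqOn (fun n => iteratedFDerivWithin ℝ j (u n) O) atTop O := by
    intro j hj
    rw [Metric.uniformCauchySeqOn_iff]
    intro ε hε
    obtain ⟨N, hN⟩ := Metric.cauchySeq_iff.1 hs (ε / (C + 1)) (by positivity)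
    refine ⟨N, fun m hm n hn y hy => ?_⟩
    rw [dist_eq_norm, hD m j y hy, hD n j y hy,
      ← chartDeriv_coord_sub (hsrc y hy) (hO y hy).2.1 _ _ hj]
    refine lt_of_le_of_lt ((hO y hy).2.2 _ j hj) ?_
    have h1 := hN m hm n hn
    rw [dist_eq_norm, lt_div_iff₀ (by positivity)] at h1
    nlinarith [norm_nonneg (s m - s n)]
  have hex : ∀ (y : ED) (j : ℕ), ∃ w : ED [×j]→L[ℝ] F, y ∈ O → j ≤ k →
      Tendsto (fun n => iteratedFDerivWithin ℝ j (u n) O y) atTop (𝓝 w) := by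
    intro y j
    by_cases h : y ∈ O ∧ j ≤ k
    · obtain ⟨w, hw⟩ := cauchySeq_tendsto_of_complete ((hcau j h.2).cauchySeq h.1)
      exact ⟨w, fun _ _ => hw⟩
    · exact ⟨0, fun h1 h2 => absurd ⟨h1, h2⟩ h⟩
  choose P hP using hex
  have hT : HasFTaylorSeriesUpToOn k (fun y => (P y 0).curry0) P O :=
    hasFTaylorSeriesUpToOn_of_tendstoUniformlyOn hOc
      (fun n => (hsm n).ftaylorSeriesWithin hOu)
      (fun j hj => (hcau j hj).tendstoUniformlyOn_of_tendsto fun y hy => hP y j hy hj)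
  have hPq : ∀ y ∈ O, (P y 0).curry0 = (q ∘ (extChartAt I c).symm) y := by
    intro y hy
    refine tendsto_nhds_unique ?_ (hq _ (hO y hy).2.1)
    exact ((continuousMultilinearCurryFin0 ℝ ED F).continuous.tendsto _).comp
      (hP y 0 hy (Nat.zero_le _))
  have hTq : HasFTaylorSeriesUpToOn k (q ∘ (extChartAt I c).symm) P O :=
    hT.congr fun y hy => (hPq y hy).symm
  constructor
  · rw [contMDiffAt_iff_source_of_mem_source hc, contMDiffWithinAt_iff_contDiffWithinAt]
    have h1 : ContDiffOn ℝ k (q ∘ (extChartAt I c).symm) O := hTq.contDiffOn (n := (k : ℕ∞))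
    exact (contDiffWithinAt_inter (Metric.ball_mem_nhds _ hr)).1 (h1 _ hx₀O)
  · intro j hj
    have h1 := hP _ j hx₀O hj
    rw [hTq.eq_iteratedFDerivWithin_of_uniqueDiffOn (by exact_mod_cast hj) hOu hx₀O,
      iteratedFDerivWithin_inter_open Metric.isOpen_ball (Metric.mem_ball_self hr)] at h1
    refine h1.congr fun n => ?_
    rw [hD n j _ hx₀O, extChartAt_symm_apply_of_mem hc]

/-- The space of `C^k` sections is a Banach space. -/
instance completeSpace_section [CompleteSpace F] : CompleteSpace Cₛ^k⟮I; F, W⟯ := by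
  refine Metric.complete_of_cauchySeq_tendsto fun s hs => ?_
  have hlim : ∀ x : D, ∃ l : F, Tendsto (fun n => coord x (s n) x) atTop (𝓝 l) := fun x =>
    cauchySeq_tendsto_of_complete
      (hs.map (coordL I k (FiberBundle.mem_baseSet_trivializationAt' (F := F) (E := W)
        x)).uniformContinuous)
  choose l hl using hlim
  -- the pointwise limit
  let σ : ∀ x, W x := fun x => (trivializationAt F W x).symmL ℝ x (l x)
  have hσ : ∀ b p : D, p ∈ (trivializationAt F W b).baseSet →
      Tendsto (fun n => coord b (s n) p) atTop
        (𝓝 ((trivializationAt F W b).continuousLinearMapAt ℝ p (σ p))) := by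
    intro b p hp
    have hpp := FiberBundle.mem_baseSet_trivializationAt' (F := F) (E := W) p
    have h1 : (trivializationAt F W b).continuousLinearMapAt ℝ p (σ p) =
        (trivializationAt F W p).coordChangeL ℝ (trivializationAt F W b) p (l p) := by
      rw [Trivialization.coordChangeL_apply _ _ ⟨hpp, hp⟩,
        Trivialization.continuousLinearMapAt_apply, Trivialization.coe_linearMapAt_of_mem _ hp]
      simp only [σ]
      rw [Trivialization.symmL_apply]
      exact hpp
    rw [h1]
    refine ((((trivializationAt F W p).coordChangeL ℝ
      (trivializationAt F W b) p).continuous.tendsto _).comp (hl p)).congr fun n => ?_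
    exact (coord_change (s n) hp hpp).symm
  have hkey := fun (b c x₀ : D) (hc : x₀ ∈ (chartAt HD c).source)
    (hb : x₀ ∈ (trivializationAt F W b).baseSet) => contMDiffAt_of_cauchySeq hs hc hb (hσ b)
  let S : Cₛ^k⟮I; F, W⟯ :=
    { toFun := σ
      contMDiff_toFun := fun x => by
        have hx := FiberBundle.mem_baseSet_trivializationAt' (F := F) (E := W) x
        refine ((trivializationAt F W x).contMDiffAt_section_iff hx).2 ?_
        refine (hkey x x x (mem_chart_source HD x) hx).1.congr_of_eventuallyEq ?_
        filter_upwards [(trivializationAt F W x).open_baseSet.mem_nhds hx] with y hy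
        rw [Trivialization.continuousLinearMapAt_apply,
          Trivialization.coe_linearMapAt_of_mem _ hy] }
  refine ⟨S, Metric.tendsto_atTop'.2 fun ε hε => ?_⟩
  obtain ⟨N, hN⟩ := Metric.cauchySeq_iff.1 hs (ε / 2) (half_pos hε)
  refine ⟨N, fun n hn => ?_⟩
  rw [dist_eq_norm]
  refine lt_of_le_of_lt (norm_le_of_norm_chartDeriv_coord_le (half_pos hε).le ?_)
    (half_lt_self hε)
  intro c hc x hx j hj
  have hxs := (compactCover HD F W).piece_subset_chart c hx
  have hxt := (compactCover HD F W).piece_subset_triv c hx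
  have h1 := (hkey c c x hxs hxt).2 j hj
  refine le_of_tendsto (x := atTop)
    (f := fun m => ‖chartDeriv I c j (coord c (s n)) x - chartDeriv I c j (coord c (s m)) x‖) ?_ ?_
  · rw [chartDeriv_coord_sub hxs hxt _ _ hj]
    exact (tendsto_const_nhds.sub h1).norm
  · filter_upwards [eventually_ge_atTop N] with m hm
    rw [← chartDeriv_coord_sub hxs hxt _ _ hj]
    refine (norm_chartDeriv_coord_le hc hx _ hj).trans ?_
    rw [← dist_eq_norm]
    exact (hN n (le_of_lt hn) m hm).le

end Completeness

/-! ### Jets and the Faà di Bruno formula -/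

section Jets

variable {ED : Type*} [NormedAddCommGroup ED] [NormedSpace ℝ ED]
  {HD : Type*} [TopologicalSpace HD] {I : ModelWithCorners ℝ ED HD}
  {D : Type*} [TopologicalSpace D] [ChartedSpace HD D]
  {Y : Type*} [NormedAddCommGroup Y] [NormedSpace ℝ Y]
  {Z : Type*} [NormedAddCommGroup Z] [NormedSpace ℝ Z]
  {F : Type*} [NormedAddCommGroup F] [NormedSpace ℝ F]
  {W : D → Type*} [TopologicalSpace (TotalSpace F W)]
  [∀ x, TopologicalSpace (W x)] [FiberBundle F W]
  [∀ x, AddCommGroup (W x)] [∀ x, Module ℝ (W x)] [VectorBundle ℝ F W] {k : ℕ}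

variable (ED Y k) in
/-- The fibre of the space of `k`-jets at a point of functions on `ED` with values in `Y`. This is a
definition, not an abbreviation, so that its only topology is the one of its norm. -/
def Jet : Type _ := ∀ i : Fin (k + 1), ED [×(i : ℕ)]→L[ℝ] Y

instance Jet.normedAddCommGroup : NormedAddCommGroup (Jet ED Y k) :=
  inferInstanceAs (NormedAddCommGroup (∀ i : Fin (k + 1), ED [×(i : ℕ)]→L[ℝ] Y))

instance Jet.normedSpace : NormedSpace ℝ (Jet ED Y k) :=
  inferInstanceAs (NormedSpace ℝ (∀ i : Fin (k + 1), ED [×(i : ℕ)]→L[ℝ] Y))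

variable (ED Y) in
/-- A component of a jet. -/
def Jet.proj (i : Fin (k + 1)) : Jet ED Y k →L[ℝ] (ED [×(i : ℕ)]→L[ℝ] Y) :=
  ContinuousLinearMap.proj (R := ℝ) (φ := fun i : Fin (k + 1) => ED [×(i : ℕ)]→L[ℝ] Y) i

variable (ED k) in
/-- The action of a linear map on jets. -/
def Jet.map (L : F →L[ℝ] Y) : Jet ED F k →L[ℝ] Jet ED Y k :=
  ContinuousLinearMap.piMap (R := ℝ) (φ := fun i : Fin (k + 1) => ED [×(i : ℕ)]→L[ℝ] F)
    (ψ := fun i : Fin (k + 1) => ED [×(i : ℕ)]→L[ℝ] Y) fun i =>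
      ContinuousLinearMap.compContinuousMultilinearMapL ℝ (fun _ : Fin (i : ℕ) => ED) F Y L

theorem Jet.norm_le_iff {J : Jet ED Y k} {a : ℝ} (ha : 0 ≤ a) :
    ‖J‖ ≤ a ↔ ∀ i, ‖Jet.proj ED Y i J‖ ≤ a :=
  pi_norm_le_iff_of_nonneg (G := fun i : Fin (k + 1) => ED [×(i : ℕ)]→L[ℝ] Y) ha

/-- The value of a jet. -/
def Jet.base (J : Jet ED Y k) : Y :=
  ContinuousMultilinearMap.curry0 (Jet.proj ED Y ⟨0, k.succ_pos⟩ J)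

theorem Jet.contDiff_base {n : ℕ∞ω} : ContDiff ℝ n (Jet.base : Jet ED Y k → Y) :=
  (continuousMultilinearCurryFin0 ℝ ED Y).contDiff.comp
    (Jet.proj ED Y (⟨0, k.succ_pos⟩ : Fin (k + 1))).contDiff

/-- The action of a smooth map `ψ` on jets given by the Faà di Bruno formula: it sends the `k`-jet
of `h` to the `j`-th derivative of `ψ ∘ h`. -/
def jetComp (ψ : Y → Z) (j : ℕ) (J : Jet ED Y k) : ED [×j]→L[ℝ] Z :=
  (ftaylorSeries ℝ ψ J.base).taylorComp
    (fun i => if h : i < k + 1 then Jet.proj ED Y ⟨i, h⟩ J else 0) j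

/-- The Faà di Bruno formula is a finite sum of terms that are multilinear in the components of the jet
and in the derivatives of `ψ` at its value, hence smooth in the jet. -/
theorem contDiffOn_jetComp [CompleteSpace Z] {ψ : Y → Z} {U : Set Y} (hU : IsOpen U)
    (hψ : ContDiffOn ℝ ∞ ψ U) (j : ℕ) :
    ContDiffOn ℝ ∞ (jetComp ψ j : Jet ED Y k → _) {J | J.base ∈ U} := by
  intro J hJ
  refine ContDiffAt.contDiffWithinAt ?_
  have hψJ : ContDiffAt ℝ ∞ ψ J.base := hψ.contDiffAt (hU.mem_nhds hJ)
  refine ContDiffAt.sum fun c _ => ?_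
  let B := c.compAlongOrderedFinpartitionL ℝ ED Y Z
  have hB : ContDiff ℝ ∞ fun p : (Y [×c.length]→L[ℝ] Z) ×
      (∀ m : Fin c.length, ED [×c.partSize m]→L[ℝ] Y) => B p.1 p.2 :=
    contDiff_iff_contDiffAt.2 fun p =>
      (B.analyticOnNhd_uncurry_of_multilinear (s := univ) p (mem_univ _)).contDiffAt
  have h1 : ContDiffAt ℝ ∞ (fun J : Jet ED Y k => iteratedFDeriv ℝ c.length ψ J.base) J :=
    ContDiffAt.comp J (hψJ.iteratedFDeriv_right (m := ∞) (i := c.length)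
      (by exact_mod_cast le_top)) Jet.contDiff_base.contDiffAt
  have h2 : ContDiffAt ℝ ∞ (fun (J : Jet ED Y k) (m : Fin c.length) =>
      (if h : c.partSize m < k + 1 then Jet.proj ED Y ⟨c.partSize m, h⟩ J else 0 :
        ED [×c.partSize m]→L[ℝ] Y)) J := by
    refine contDiffAt_pi.2 fun m => ?_
    by_cases h : c.partSize m < k + 1
    · simp only [dif_pos h]
      exact (Jet.proj ED Y (⟨c.partSize m, h⟩ : Fin (k + 1))).contDiff.contDiffAt
    · simp only [dif_neg h]
      exact contDiffAt_const
  exact hB.contDiffAt.comp J (h1.prodMk h2)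

theorem taylorComp_congr_right {X : Type*} [NormedAddCommGroup X] [NormedSpace ℝ X]
    (q : FormalMultilinearSeries ℝ Y Z) {p p' : FormalMultilinearSeries ℝ X Y} {j : ℕ}
    (h : ∀ i ≤ j, p i = p' i) : q.taylorComp p j = q.taylorComp p' j := by
  refine Finset.sum_congr rfl fun c _ => ?_
  rw [FormalMultilinearSeries.compAlongOrderedFinpartition,
    FormalMultilinearSeries.compAlongOrderedFinpartition]
  congr 1
  exact funext fun m => h _ (c.partSize_le m)

variable [IsManifold I ∞ D]

variable (I k) in
/-- The `k`-jet of a function on `D`, read in the preferred chart at `c`. -/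
def chartJet (c : D) (q : D → Y) (x : D) : Jet ED Y k := fun i => chartDeriv I c i q x

omit [IsManifold I ∞ D] in
theorem base_chartJet {c x : D} (hx : x ∈ (chartAt HD c).source) (q : D → Y) :
    (chartJet I k c q x).base = q x := by
  change q ((extChartAt I c).symm (extChartAt I c x)) = q x
  rw [extChartAt_symm_apply_of_mem hx]

theorem jetComp_chartJet {c x : D} (hx : x ∈ (chartAt HD c).source)
    {q : D → Y} (hq : ContMDiffAt I 𝓘(ℝ, Y) k q x) {ψ : Y → Z} (hψ : ContDiffAt ℝ k ψ (q x))
    {j : ℕ} (hj : j ≤ k) :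
    jetComp ψ j (chartJet I k c q x) = chartDeriv I c j (fun p => ψ (q p)) x := by
  have h := chartDeriv_comp hx hq uniqueDiffOn_univ (fun _ => mem_univ _)
    (contDiffWithinAt_univ.2 hψ) hj
  rw [ftaylorSeriesWithin_univ] at h
  change _ = chartDeriv I c j (ψ ∘ q) x
  rw [h, jetComp, base_chartJet hx]
  refine taylorComp_congr_right _ fun i hi => ?_
  rw [dif_pos (Nat.lt_succ_iff.2 (hi.trans hj))]
  rfl

theorem continuousAt_chartJet {c x : D} (hx : x ∈ (chartAt HD c).source)
    {q : D → Y} (hq : ContMDiffAt I 𝓘(ℝ, Y) k q x) : ContinuousAt (chartJet I k c q) x :=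
  continuousAt_pi (A := fun i : Fin (k + 1) => ED [×(i : ℕ)]→L[ℝ] Y).2 fun i =>
    continuousAt_chartDeriv hx hq (Nat.lt_succ_iff.1 i.2)

variable [ContMDiffVectorBundle k F W I] [CompactSpace D] [T2Space D]

variable (I F W k) in
/-- `jetMap` as a continuous linear map; the norm of sections is induced by it. -/
def jetMapL : Cₛ^k⟮I; F, W⟯ →L[ℝ] JetSpace ED HD F W k where
  toLinearMap := jetMap I F W k
  cont := continuous_induced_dom

set_option synthInstance.maxHeartbeats 200000 in
/-- A map into the space of `C^k` sections is smooth if all the partial derivatives of the coordinate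
expressions depend smoothly on the argument, uniformly over the compact sets of the cover. -/
theorem contDiffAt_of_jetMap [CompleteSpace F] {E : Type*} [NormedAddCommGroup E]
    [NormedSpace ℝ E] {f : E → Cₛ^k⟮I; F, W⟯} {y₀ : E}
    (h : ∀ (c : (compactCover HD F W).centers) (j : Fin (k + 1)),
      ContDiffAt ℝ ∞ (fun y => jetMap I F W k (f y) c j) y₀) : ContDiffAt ℝ ∞ f y₀ := by
  refine contDiffAt_of_comp_of_bound (G := JetSpace ED HD F W k) (jetMapL I F W k) (C := 1)
    (fun s => by rw [one_mul]; exact le_rfl) ?_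
  exact contDiffAt_pi.2 fun c => contDiffAt_pi.2 fun j => h c j

variable {K : Type*} [TopologicalSpace K] [CompactSpace K]

/-- The `k`-jets over a compact set of the coordinates of sections, as a continuous linear map. -/
def sectionJetL (ι : C(K, D)) {b c : D} (hc : ∀ x, ι x ∈ (chartAt HD c).source)
    (hb : ∀ x, ι x ∈ (trivializationAt F W b).baseSet) {C : ℝ}
    (hC : ∀ x, ∀ s : Cₛ^k⟮I; F, W⟯, ∀ j ≤ k, ‖chartDeriv I c j (coord b s) (ι x)‖ ≤ C * ‖s‖) :
    Cₛ^k⟮I; F, W⟯ →L[ℝ] C(K, Jet ED F k) :=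
  LinearMap.mkContinuous
    { toFun := fun s =>
        { toFun := fun x => chartJet I k c (coord b s) (ι x)
          continuous_toFun := continuous_iff_continuousAt.2 fun x =>
            (continuousAt_chartJet (hc x) (contMDiffAt_coord s (hb x))).comp
              ι.continuous.continuousAt }
      map_add' := fun s t => by
        ext1 x
        funext i
        exact chartDeriv_coord_add (hc x) (hb x) s t (Nat.lt_succ_iff.1 i.2)
      map_smul' := fun a s => by
        ext1 x
        funext i
        exact chartDeriv_coord_smul (hc x) (hb x) a s (Nat.lt_succ_iff.1 i.2) }
    (max C 0) fun s => by
      rw [ContinuousMap.norm_le _ (by positivity)]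
      intro x
      rw [Jet.norm_le_iff (by positivity)]
      intro i
      exact (hC x s i (Nat.lt_succ_iff.1 i.2)).trans
        (mul_le_mul_of_nonneg_right (le_max_left _ _) (norm_nonneg _))

/-- Smooth dependence on the section `σ`, uniformly over a compact set, of the derivatives of
`p ↦ ψ (h₀ p + L (σ p))`. -/
theorem contDiffAt_chartDeriv_comp [T2Space K] [CompleteSpace Z] (ι : C(K, D)) {b c : D}
    (hc : ∀ x, ι x ∈ (chartAt HD c).source)
    (hb : ∀ x, ι x ∈ (trivializationAt F W b).baseSet) {C : ℝ}
    (hC : ∀ x, ∀ s : Cₛ^k⟮I; F, W⟯, ∀ j ≤ k, ‖chartDeriv I c j (coord b s) (ι x)‖ ≤ C * ‖s‖)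
    {h₀ : D → Y} (hh₀ : ∀ x, ContMDiffAt I 𝓘(ℝ, Y) k h₀ (ι x)) (L : F →L[ℝ] Y)
    {ψ : Y → Z} {U : Set Y} (hU : IsOpen U) (hψ : ContDiffOn ℝ ∞ ψ U)
    {s₀ : Cₛ^k⟮I; F, W⟯} (hs₀ : ∀ x, h₀ (ι x) + L (coord b s₀ (ι x)) ∈ U) {j : ℕ} (hj : j ≤ k)
    {A : Cₛ^k⟮I; F, W⟯ → C(K, ED [×j]→L[ℝ] Z)}
    (hA : ∀ᶠ s in 𝓝 s₀, ∀ x, A s x =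
      chartDeriv I c j (fun p => ψ (h₀ p + L (coord b s p))) (ι x)) :
    ContDiffAt ℝ ∞ A s₀ := by
  let a₀ : C(K, Jet ED Y k) :=
    { toFun := fun x => chartJet I k c h₀ (ι x)
      continuous_toFun := continuous_iff_continuousAt.2 fun x =>
        (continuousAt_chartJet (hc x) (hh₀ x)).comp ι.continuous.continuousAt }
  let R : Cₛ^k⟮I; F, W⟯ → C(K, Jet ED Y k) := fun s =>
    a₀ + ((Jet.map ED k L).compLeftContinuous ℝ K) (sectionJetL ι hc hb hC s)
  have hR : ContDiff ℝ ∞ R :=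
    contDiff_const.add ((ContinuousLinearMap.contDiff _).comp (ContinuousLinearMap.contDiff _))
  have hsm : ∀ s x, ContMDiffAt I 𝓘(ℝ, Y) k (fun p => h₀ p + L (coord b s p)) (ι x) :=
    fun s x => (hh₀ x).add (L.contMDiff.contMDiffAt.comp _ (contMDiffAt_coord s (hb x)))
  have hRj : ∀ s x, R s x = chartJet I k c (fun p => h₀ p + L (coord b s p)) (ι x) := by
    intro s x
    funext i
    have hi : (i : ℕ) ≤ k := Nat.lt_succ_iff.1 i.2
    have h1 := chartDeriv_add (hc x) (hh₀ x)
      (L.contMDiff.contMDiffAt.comp _ (contMDiffAt_coord s (hb x))) hi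
    have h2 := chartDeriv_clm_comp (hc x) (contMDiffAt_coord s (hb x)) hi L
    refine Eq.trans ?_ h1.symm
    exact congrArg (fun w => chartDeriv I c i h₀ (ι x) + w) h2.symm
  have hO : IsOpen {J : Jet ED Y k | J.base ∈ U} :=
    hU.preimage (Jet.contDiff_base (n := 0)).continuous
  have hR₀ : ∀ x, R s₀ x ∈ {J : Jet ED Y k | J.base ∈ U} := fun x => by
    change (R s₀ x).base ∈ U
    rw [hRj, base_chartJet (hc x)]
    exact hs₀ x
  have hjc : ContDiffOn ℝ ∞ (jetComp ψ j : Jet ED Y k → ED [×j]→L[ℝ] Z) {J | J.base ∈ U} :=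
    contDiffOn_jetComp hU hψ j
  have hP : ContDiffAt ℝ ∞ (postComp (K := K) (jetComp ψ j : Jet ED Y k → ED [×j]→L[ℝ] Z)) (R s₀) :=
    (contDiffOn_postComp hO hjc).contDiffAt ((isOpen_setOf_forall_mem hO).mem_nhds hR₀)
  refine (hP.comp s₀ hR.contDiffAt).congr_of_eventuallyEq ?_
  have hev : ∀ᶠ s in 𝓝 s₀, ∀ x, R s x ∈ {J : Jet ED Y k | J.base ∈ U} :=
    hR.continuous.continuousAt.eventually ((isOpen_setOf_forall_mem hO).mem_nhds hR₀)
  filter_upwards [hA, hev] with s hs hsU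
  ext1 x
  have hsx : h₀ (ι x) + L (coord b s (ι x)) ∈ U := by
    have h : (R s x).base ∈ U := hsU x
    rwa [hRj, base_chartJet (hc x)] at h
  rw [hs x, Function.comp_apply, postComp_apply hjc.continuousOn hsU, hRj]
  exact (jetComp_chartJet (hc x) (hsm s x)
    ((hψ.contDiffAt (hU.mem_nhds hsx)).of_le (by exact_mod_cast le_top)) hj).symm

end Jets

/-! ### Left-composition on spaces of sections -/

section Fibrewise

variable {ED : Type*} [NormedAddCommGroup ED] [NormedSpace ℝ ED]
  {HD : Type*} [TopologicalSpace HD] {I : ModelWithCorners ℝ ED HD}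
  {D : Type*} [TopologicalSpace D] [ChartedSpace HD D]
  {EN : Type*} [NormedAddCommGroup EN] [NormedSpace ℝ EN]
  {HN : Type*} [TopologicalSpace HN] {J : ModelWithCorners ℝ EN HN}
  {N : Type*} [TopologicalSpace N] [ChartedSpace HN N]
  {F : Type*} [NormedAddCommGroup F] [NormedSpace ℝ F]
  {V : N → Type*} [TopologicalSpace (TotalSpace F V)] [∀ x, TopologicalSpace (V x)]
  [∀ x, AddCommGroup (V x)] [∀ x, Module ℝ (V x)] [FiberBundle F V] [VectorBundle ℝ F V]
  [IsManifold J ∞ N] [ContMDiffVectorBundle ∞ F V J]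
  {EN' : Type*} [NormedAddCommGroup EN'] [NormedSpace ℝ EN']
  {HN' : Type*} [TopologicalSpace HN'] {J' : ModelWithCorners ℝ EN' HN'}
  {N' : Type*} [TopologicalSpace N'] [ChartedSpace HN' N']
  {F' : Type*} [NormedAddCommGroup F'] [NormedSpace ℝ F']
  {V' : N' → Type*} [TopologicalSpace (TotalSpace F' V')] [∀ x, TopologicalSpace (V' x)]
  [∀ x, AddCommGroup (V' x)] [∀ x, Module ℝ (V' x)] [FiberBundle F' V'] [VectorBundle ℝ F' V']
  [ContMDiffVectorBundle ∞ F' V' J']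
  {k : ℕ} [CompactSpace D] [T2Space D] [IsManifold I ∞ D]

omit [IsManifold J ∞ N] [CompactSpace D] [T2Space D] [IsManifold I ∞ D]
  [ContMDiffVectorBundle ∞ F V J] in
/-- The preferred trivialization at `b` of the pull-back bundle is induced by that of the bundle
itself at `g b`. -/
theorem coord_eq_snd_toMap {g : C^k⟮I, D; J, N⟯} (s : SectionAlong F V g) {b p : D}
    (hp : g p ∈ (trivializationAt F V (g b)).baseSet) :
    coord b s p = (trivializationAt F V (g b) (s.toMap p)).2 :=
  coord_apply s hp

omit [IsManifold J ∞ N] in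
/-- Evaluation of sections is jointly continuous in the section and the point. -/
theorem continuousAt_eval {g : C^k⟮I, D; J, N⟯} (s₀ : SectionAlong F V g) (x₀ : D) :
    ContinuousAt (fun z : SectionAlong F V g × D => z.1.toMap z.2) (s₀, x₀) := by
  rw [FiberBundle.continuousAt_totalSpace]
  refine ⟨g.contMDiff.continuous.continuousAt.comp_of_eq continuousAt_snd rfl, ?_⟩
  have hb : x₀ ∈ (trivializationAt F (g *ᵖ V) x₀).baseSet :=
    FiberBundle.mem_baseSet_trivializationAt' x₀
  obtain ⟨C, hC0, hC⟩ := exists_eventually_norm_coord_le I F (g *ᵖ V) k hb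
  have h1 : ContinuousAt (fun z : SectionAlong F V g × D => coord x₀ z.1 z.2) (s₀, x₀) := by
    rw [ContinuousAt, tendsto_iff_norm_sub_tendsto_zero]
    have hlim : Tendsto (fun z : SectionAlong F V g × D =>
        C * ‖z.1 - s₀‖ + ‖coord x₀ s₀ z.2 - coord x₀ s₀ x₀‖) (𝓝 (s₀, x₀)) (𝓝 0) := by
      have h2 : ContinuousAt (fun z : SectionAlong F V g × D =>
          C * ‖z.1 - s₀‖ + ‖coord x₀ s₀ z.2 - coord x₀ s₀ x₀‖) (s₀, x₀) :=
        (continuousAt_const.mul (continuousAt_fst.sub continuousAt_const).norm).add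
          ((((contMDiffAt_coord s₀ hb).continuousAt).comp_of_eq continuousAt_snd rfl).sub
            continuousAt_const).norm
      simpa [ContinuousAt] using h2
    refine squeeze_zero' (Eventually.of_forall fun _ => norm_nonneg _) ?_ hlim
    filter_upwards [(continuous_snd.tendsto (s₀, x₀)).eventually hC] with z hz
    have h3 : coord x₀ z.1 z.2 = coord x₀ (z.1 - s₀) z.2 + coord x₀ s₀ z.2 := by
      have := congrFun (coord_add x₀ (z.1 - s₀) s₀) z.2
      rwa [sub_add_cancel] at this
    calc ‖coord x₀ z.1 z.2 - coord x₀ s₀ x₀‖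
        = ‖coord x₀ (z.1 - s₀) z.2 + (coord x₀ s₀ z.2 - coord x₀ s₀ x₀)‖ := by
          rw [h3, add_sub_assoc]
      _ ≤ _ := norm_add_le_of_le (hz _) le_rfl
  refine h1.congr ?_
  filter_upwards [(continuous_snd.tendsto (s₀, x₀)).eventually
    ((trivializationAt F (g *ᵖ V) x₀).open_baseSet.mem_nhds hb)] with z hz
  exact coord_eq_snd_toMap z.1 hz

omit [IsManifold J ∞ N] in
theorem eventually_forall_toMap_mem {g : C^k⟮I, D; J, N⟯} {s₀ : SectionAlong F V g}
    {O : Set (TotalSpace F V)} (hO : IsOpen O) (h : ∀ p, s₀.toMap p ∈ O) :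
    ∀ᶠ s : SectionAlong F V g in 𝓝 s₀, ∀ p, s.toMap p ∈ O := by
  have := isCompact_univ.eventually_forall_of_forall_eventually (x₀ := s₀) (K := (univ : Set D))
    (P := fun s p => s.toMap p ∈ O)
    (fun x _ => (continuousAt_eval s₀ x).eventually (hO.mem_nhds (h x)))
  simpa using this

variable [J.Boundaryless]

/-- The omega lemma: if `Ψ` is a smooth map between the total spaces of two vector
bundles, defined near the image of a section `s₀` along `g`, then the map `s ↦ Ψ ∘ s` between spaces
of sections is smooth near `s₀`. -/
theorem contDiffAt_of_toMap_eq [CompleteSpace F'] {g : C^k⟮I, D; J, N⟯} {g' : C^k⟮I, D; J', N'⟯}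
    {s₀ : SectionAlong F V g} {O : Set (TotalSpace F V)} (hO : IsOpen O) (hs₀ : ∀ p, s₀.toMap p ∈ O)
    {Ψ : TotalSpace F V → TotalSpace F' V'}
    (hΨ : ContMDiffOn (J.prod 𝓘(ℝ, F)) (J'.prod 𝓘(ℝ, F')) ∞ Ψ O)
    {G : SectionAlong F V g → SectionAlong F' V' g'}
    (hG : ∀ᶠ s in 𝓝 s₀, ∀ p, (G s).toMap p = Ψ (s.toMap p)) : ContDiffAt ℝ ∞ G s₀ := by
  refine contDiffAt_of_jetMap fun c j => contDiffAt_of_restrict fun x₀ => ?_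
  have hj : (j : ℕ) ≤ k := Nat.lt_succ_iff.1 j.2
  have hb : (x₀ : D) ∈ (trivializationAt F (g *ᵖ V) (x₀ : D)).baseSet :=
    FiberBundle.mem_baseSet_trivializationAt' _
  have hpc : ∀ x : (compactCover HD F' (g' *ᵖ V')).piece c, (x : D) ∈ (chartAt HD (c : D)).source :=
    fun x => (compactCover HD F' (g' *ᵖ V')).piece_subset_chart c x.2
  have hpb : ∀ x : (compactCover HD F' (g' *ᵖ V')).piece c,
      g' x ∈ (trivializationAt F' V' (g' c)).baseSet :=
    fun x => (compactCover HD F' (g' *ᵖ V')).piece_subset_triv c x.2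
  obtain ⟨C, hC0, hC⟩ := exists_norm_chartDeriv_coord_le I F (g *ᵖ V) k (hpc x₀) hb
  have hgx : ∀ᶠ x in 𝓝 (x₀ : D), g x ∈ (chartAt HN (g x₀)).source :=
    g.contMDiff.continuous.continuousAt.eventually
      ((chartAt HN (g x₀)).open_source.mem_nhds (mem_chart_source HN (g x₀)))
  obtain ⟨S, hS, hSsub, hScomp⟩ := local_compact_nhds
    (continuous_subtype_val.continuousAt.eventually (hC.and (hgx.and
      ((trivializationAt F (g *ᵖ V) (x₀ : D)).open_baseSet.mem_nhds hb))))
  have hcS : CompactSpace S := isCompact_iff_compactSpace.1 hScomp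
  refine ⟨S, hS, hcS, ?_⟩
  let ι : C(S, D) := ⟨fun x => ((x : (compactCover HD F' (g' *ᵖ V')).piece c) : D), by fun_prop⟩
  have hι : ∀ x : S, g' (ι x) ∈ (trivializationAt F' V' (g' c)).baseSet := fun x => hpb x
  have hιC : ∀ x : S, ∀ s : SectionAlong F V g, ∀ j ≤ k,
      ‖chartDeriv I (c : D) j (coord (x₀ : D) s) (ι x)‖ ≤ C * ‖s‖ := fun x => (hSsub x.2).1
  have hιs : ∀ x : S, g (ι x) ∈ (chartAt HN (g x₀)).source := fun x => (hSsub x.2).2.1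
  have hιb : ∀ x : S, g (ι x) ∈ (trivializationAt F V (g x₀)).baseSet := fun x => (hSsub x.2).2.2
  -- coordinates on the two total spaces
  let χ := extChartAt (J.prod 𝓘(ℝ, F)) (s₀.toMap x₀)
  let B : Set (TotalSpace F' V') := π F' V' ⁻¹' (trivializationAt F' V' (g' c)).baseSet
  have hB : IsOpen B :=
    (trivializationAt F' V' (g' c)).open_baseSet.preimage (FiberBundle.continuous_proj F' V')
  let O' : Set (TotalSpace F V) := O ∩ Ψ ⁻¹' B
  have hO' : IsOpen O' := hΨ.continuousOn.isOpen_inter_preimage hO hB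
  let U : Set (EN × F) := χ.target ∩ χ.symm ⁻¹' O'
  have hU : IsOpen U := (continuousOn_extChartAt_symm _).isOpen_inter_preimage
    (isOpen_extChartAt_target _) hO'
  -- the fibre coordinate of `Ψ`
  let ψ : EN × F → F' := fun y => (trivializationAt F' V' (g' c) (Ψ (χ.symm y))).2
  have hψ : ContDiffOn ℝ ∞ ψ U := by
    rw [← contMDiffOn_iff_contDiffOn]
    have h1 : ContMDiffOn (J'.prod 𝓘(ℝ, F')) 𝓘(ℝ, F') ∞
        (fun w => (trivializationAt F' V' (g' c) w).2) B := by
      have h := (trivializationAt F' V' (g' c)).contMDiffOn (n := ∞) (IB := J')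
      rw [Trivialization.source_eq] at h
      exact contMDiff_snd.comp_contMDiffOn h
    have h2 : ContMDiffOn 𝓘(ℝ, EN × F) (J.prod 𝓘(ℝ, F)) ∞ χ.symm U :=
      (contMDiffOn_extChartAt_symm _).mono inter_subset_left
    exact h1.comp (hΨ.comp h2 fun y hy => hy.2.1) fun y hy => hy.2.2
  -- `χ` maps the value of a section at `p` to `h₀ p + L (coord x₀ s p)`, affine in the section
  let h₀ : D → EN × F := fun p => (extChartAt J (g x₀) (g p), 0)
  let L : F →L[ℝ] EN × F := ContinuousLinearMap.inr ℝ EN F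
  have hχ : ∀ (s : SectionAlong F V g) (p : D),
      g p ∈ (trivializationAt F V (g x₀)).baseSet →
        h₀ p + L (coord (x₀ : D) s p) = χ (s.toMap p) := by
    intro s p hp
    have h : χ (s.toMap p) = (extChartAt J (g x₀) (trivializationAt F V (g x₀) (s.toMap p)).1,
        (trivializationAt F V (g x₀) (s.toMap p)).2) := by
      simp only [χ]
      rw [FiberBundle.extChartAt]
      rfl
    rw [h, Trivialization.coe_fst' _ hp, coord_eq_snd_toMap s hp]
    simp only [h₀, L, ContinuousLinearMap.inr_apply, Prod.mk_add_mk, add_zero, zero_add]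
    rfl
  have hχs : ∀ (s : SectionAlong F V g) (p : D), g p ∈ (chartAt HN (g x₀)).source →
      g p ∈ (trivializationAt F V (g x₀)).baseSet → s.toMap p ∈ χ.source := by
    intro s p hp hp'
    simp only [χ]
    rw [FiberBundle.extChartAt, PartialEquiv.trans_source]
    refine ⟨(trivializationAt F V (g x₀)).mem_source.2 hp', ?_, mem_univ _⟩
    change (trivializationAt F V (g x₀) (s.toMap p)).1 ∈ (extChartAt J (g x₀)).source
    rw [Trivialization.coe_fst' _ hp', extChartAt_source]
    exact hp
  refine contDiffAt_chartDeriv_comp (W := g *ᵖ V) (s₀ := s₀) (h₀ := h₀) (c := (c : D)) ι (b := x₀)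
    (C := C) (fun x => hpc x) hιb hιC ?_ L hU hψ ?_ hj ?_
  · intro x
    have h1 : ContMDiffAt I 𝓘(ℝ, EN) k (fun p => extChartAt J (g x₀) (g p)) (ι x) :=
      (contMDiffAt_extChartAt' (hιs x)).comp _ g.contMDiff.contMDiffAt
    exact h1.prodMk_space contMDiffAt_const
  · intro x
    rw [hχ s₀ (ι x) (hιb x)]
    have hx := hχs s₀ (ι x) (hιs x) (hιb x)
    refine ⟨χ.map_source hx, ?_⟩
    rw [mem_preimage, χ.left_inv hx]
    refine ⟨hs₀ _, ?_⟩
    rw [mem_preimage, ← hG.self_of_nhds]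
    exact hι x
  · filter_upwards [hG] with s hs x
    change chartDeriv I (c : D) j (coord (c : D) (G s)) (ι x) = _
    refine chartDeriv_congr (hpc x) ?_ j
    have hg := g.contMDiff.continuous.continuousAt (x := ι x)
    have hg' := g'.contMDiff.continuous.continuousAt (x := ι x)
    filter_upwards [hg.eventually ((chartAt HN (g x₀)).open_source.mem_nhds (hιs x)),
      hg.eventually ((trivializationAt F V (g x₀)).open_baseSet.mem_nhds (hιb x)),
      hg'.eventually ((trivializationAt F' V' (g' c)).open_baseSet.mem_nhds (hι x))]
      with p hp1 hp2 hp3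
    rw [hχ s p hp2, coord_eq_snd_toMap _ hp3, hs p]
    simp only [ψ]
    rw [χ.left_inv (hχs s p hp1 hp2)]

end Fibrewise

/-! ### The action of a bundle morphism on sections -/

section FibrewiseLinear

variable {ED : Type*} [NormedAddCommGroup ED] [NormedSpace ℝ ED]
  {HD : Type*} [TopologicalSpace HD] {I : ModelWithCorners ℝ ED HD}
  {D : Type*} [TopologicalSpace D] [ChartedSpace HD D]
  {EN : Type*} [NormedAddCommGroup EN] [NormedSpace ℝ EN]
  {HN : Type*} [TopologicalSpace HN] {J : ModelWithCorners ℝ EN HN}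
  {N : Type*} [TopologicalSpace N] [ChartedSpace HN N]
  {F : Type*} [NormedAddCommGroup F] [NormedSpace ℝ F]
  {V : N → Type*} [TopologicalSpace (TotalSpace F V)] [∀ x, TopologicalSpace (V x)]
  [∀ x, AddCommGroup (V x)] [∀ x, Module ℝ (V x)] [FiberBundle F V] [VectorBundle ℝ F V]
  [IsManifold J ∞ N] [ContMDiffVectorBundle ∞ F V J] [J.Boundaryless]
  {EN' : Type*} [NormedAddCommGroup EN'] [NormedSpace ℝ EN']
  {HN' : Type*} [TopologicalSpace HN'] {J' : ModelWithCorners ℝ EN' HN'}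
  {N' : Type*} [TopologicalSpace N'] [ChartedSpace HN' N']
  {F' : Type*} [NormedAddCommGroup F'] [NormedSpace ℝ F'] [CompleteSpace F']
  {V' : N' → Type*} [TopologicalSpace (TotalSpace F' V')] [∀ x, TopologicalSpace (V' x)]
  [∀ x, AddCommGroup (V' x)] [∀ x, Module ℝ (V' x)] [FiberBundle F' V'] [VectorBundle ℝ F' V']
  [ContMDiffVectorBundle ∞ F' V' J']
  {k : ℕ} [CompactSpace D] [T2Space D] [IsManifold I ∞ D]

/-- A smooth morphism of vector bundles covering `f` acts by a continuous linear map on sections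
along `g`. -/
def morphismL (f : C^∞⟮J, N; J', N'⟯) (A : ∀ x, V x →ₗ[ℝ] V' (f x))
    (hA : ContMDiff (J.prod 𝓘(ℝ, F)) (J'.prod 𝓘(ℝ, F')) ∞
      (fun v : TotalSpace F V => (⟨f v.proj, A v.proj v.2⟩ : TotalSpace F' V')))
    (g : C^k⟮I, D; J, N⟯) : SectionAlong F V g →L[ℝ] SectionAlong F' V' (compLeft f g) :=
  let Λ : SectionAlong F V g →ₗ[ℝ] SectionAlong F' V' (compLeft f g) :=
    { toFun := fun s => SectionAlong.ofMap (compLeft ⟨_, hA⟩ s.toMap) (fun _ => rfl)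
      map_add' := fun s t => by
        ext p
        exact (A (g p)).map_add (s p) (t p)
      map_smul' := fun c s => by
        ext p
        exact (A (g p)).map_smul c (s p) }
  { toLinearMap := Λ
    cont := by
      -- the omega lemma includes continuity at `0`
      have h : ContDiffAt ℝ ∞ Λ 0 := contDiffAt_of_toMap_eq isOpen_univ (fun _ => mem_univ _)
        hA.contMDiffOn (Eventually.of_forall fun _ _ => rfl)
      exact continuous_of_continuousAt_zero Λ h.continuousAt }

end FibrewiseLinear

/-! ### Left-composition in the charts of the manifold of maps -/

section Composition

variable {ED : Type*} [NormedAddCommGroup ED] [NormedSpace ℝ ED]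
  {HD : Type*} [TopologicalSpace HD] {I : ModelWithCorners ℝ ED HD}
  {D : Type*} [TopologicalSpace D] [ChartedSpace HD D]
  {EN : Type*} [NormedAddCommGroup EN] [NormedSpace ℝ EN]
  {HN : Type*} [TopologicalSpace HN] {J : ModelWithCorners ℝ EN HN}
  {N : Type*} [TopologicalSpace N] [ChartedSpace HN N]
  {EN' : Type*} [NormedAddCommGroup EN'] [NormedSpace ℝ EN']
  {HN' : Type*} [TopologicalSpace HN'] {J' : ModelWithCorners ℝ EN' HN'}
  {N' : Type*} [TopologicalSpace N'] [ChartedSpace HN' N']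
  [IsManifold J ∞ N] [IsManifold J' ∞ N'] {k : ℕ}

namespace LocalAddition

/-- The expression of `f : N → N'` through local additions on `N` and `N'`: a tangent vector `v` at
`x` is sent to the tangent vector at `f x` that the second local addition maps to `f (α v)`, where
`α` is the first one. It is meaningful on `LocalAddition.liftSource` only. -/
def lift (e : LocalAddition J N) (e' : LocalAddition J' N') (f : C^∞⟮J, N; J', N'⟯)
    (v : TangentBundle J N) : TangentBundle J' N' :=
  e'.toHomeo.symm (f v.proj, f (e.toHomeo v).2)

/-- The set on which `LocalAddition.lift` is defined. -/
def liftSource (e : LocalAddition J N) (e' : LocalAddition J' N') (f : C^∞⟮J, N; J', N'⟯) :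
    Set (TangentBundle J N) :=
  e.toHomeo.source ∩ (fun v => (f v.proj, f (e.toHomeo v).2)) ⁻¹' e'.toHomeo.target

variable (e : LocalAddition J N) (e' : LocalAddition J' N') (f : C^∞⟮J, N; J', N'⟯)

omit [IsManifold J' ∞ N'] in
theorem contMDiffOn_prodMk_apply_snd : ContMDiffOn J.tangent (J'.prod J') ∞
    (fun v => (f v.proj, f (e.toHomeo v).2)) e.toHomeo.source :=
  (f.contMDiff.comp (contMDiff_proj (TangentSpace J : N → Type _))).contMDiffOn.prodMk
    ((f.contMDiff.comp contMDiff_snd).comp_contMDiffOn e.contMDiffOn)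

theorem isOpen_liftSource : IsOpen (e.liftSource e' f) :=
  (contMDiffOn_prodMk_apply_snd e f).continuousOn.isOpen_inter_preimage e.toHomeo.open_source
    e'.toHomeo.open_target

theorem contMDiffOn_lift :
    ContMDiffOn J.tangent J'.tangent ∞ (e.lift e' f) (e.liftSource e' f) :=
  e'.contMDiffOn_symm.comp ((contMDiffOn_prodMk_apply_snd e f).mono inter_subset_left) fun _ h => h.2

variable {e e' f} {g : C^k⟮I, D; J, N⟯}

theorem zero_mem_liftSource (he : e.IsDefinedAlong g) (he' : e'.IsDefinedAlong (compLeft f g))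
    (p : D) : (0 : Tangent g).toMap p ∈ e.liftSource e' f := by
  refine ⟨he p, ?_⟩
  change (f (g p), f (e.toHomeo (⟨g p, 0⟩ : TangentBundle J N)).2) ∈ e'.toHomeo.target
  rw [e.apply_zero _ (he p)]
  have h := e'.toHomeo.map_source (he' p)
  rwa [e'.apply_zero _ (he' p)] at h

theorem chart_symm_apply {σ : Tangent g} (hσ : ∀ p, σ.toMap p ∈ e.toHomeo.source) (p : D) :
    (e.chart g).symm σ p = (e.toHomeo (σ.toMap p)).2 := by
  have h : (e.chart g).symm σ = e.applyMap σ.toMap hσ := dif_pos hσ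
  rw [h]
  rfl

theorem toMap_chart_apply {h : C^k⟮I, D; J, N⟯} (hh : h ∈ (e.chart g).source) (p : D) :
    (e.chart g h).toMap p = e.toHomeo.symm (g p, h p) := by
  have h1 : e.chart g h = SectionAlong.ofMap (e.symmMap g h hh) (e.proj_symmMap hh) := dif_pos hh
  rw [h1, SectionAlong.toMap_ofMap]
  rfl

theorem compLeft_mem_chart_source {σ : Tangent g} (hσ : ∀ p, σ.toMap p ∈ e.liftSource e' f) :
    compLeft f ((e.chart g).symm σ) ∈ (e'.chart (compLeft f g)).source := by
  intro p
  change (f (g p), f ((e.chart g).symm σ p)) ∈ e'.toHomeo.target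
  rw [chart_symm_apply fun p => (hσ p).1]
  exact (hσ p).2

theorem toMap_chart_compLeft {σ : Tangent g} (hσ : ∀ p, σ.toMap p ∈ e.liftSource e' f) (p : D) :
    (e'.chart (compLeft f g) (compLeft f ((e.chart g).symm σ))).toMap p =
      e.lift e' f (σ.toMap p) := by
  rw [toMap_chart_apply (compLeft_mem_chart_source hσ)]
  change e'.toHomeo.symm (f (g p), f ((e.chart g).symm σ p)) = _
  rw [chart_symm_apply fun p => (hσ p).1]
  rfl

variable [CompactSpace D] [T2Space D] [IsManifold I ∞ D]

theorem eventually_mem_liftSource (he : e.IsDefinedAlong g)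
    (he' : e'.IsDefinedAlong (compLeft f g)) :
    ∀ᶠ σ in 𝓝 (0 : Tangent g), ∀ p, σ.toMap p ∈ e.liftSource e' f :=
  eventually_forall_toMap_mem (isOpen_liftSource e e' f) (zero_mem_liftSource he he')

theorem contDiffAt_chart_compLeft [J.Boundaryless] [CompleteSpace EN'] (he : e.IsDefinedAlong g)
    (he' : e'.IsDefinedAlong (compLeft f g)) :
    ContDiffAt ℝ ∞ (fun σ : Tangent g =>
      e'.chart (compLeft f g) (compLeft f ((e.chart g).symm σ))) 0 :=
  contDiffAt_of_toMap_eq (isOpen_liftSource e e' f) (zero_mem_liftSource he he')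
    (contMDiffOn_lift e e' f)
    ((eventually_mem_liftSource he he').mono fun _ hσ p => toMap_chart_compLeft hσ p)

end LocalAddition

variable [CompactSpace D] [T2Space D] [IsManifold I ∞ D] [J.Boundaryless] [CompleteSpace EN']

/-- Left-composition with a smooth map is a smooth map between spaces of `C^k` maps. -/
theorem smooth_compLeft (f : C^∞⟮J, N; J', N'⟯) :
    Smooth (compLeft f : C^k⟮I, D; J, N⟯ → C^k⟮I, D; J', N'⟯) := fun _ _ _ he he' =>
  ⟨(LocalAddition.eventually_mem_liftSource he he').mono fun _ hσ =>
    LocalAddition.compLeft_mem_chart_source hσ,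
    LocalAddition.contDiffAt_chart_compLeft he he'⟩

/-- The map `η ↦ df ∘ η` from sections of `TN` along `g` to sections of `TN'` along `f ∘ g`. -/
def tangentL (f : C^∞⟮J, N; J', N'⟯) (g : C^k⟮I, D; J, N⟯) :
    Tangent g →L[ℝ] Tangent (compLeft f g) :=
  morphismL f (fun x => (mfderiv J J' f x : TangentSpace J x →ₗ[ℝ] TangentSpace J' (f x)))
    (f.contMDiff.contMDiff_tangentMap (m := ∞) le_rfl) g

end Composition

/-! ### The differential of left-composition -/

section Differential

variable {ED : Type*} [NormedAddCommGroup ED] [NormedSpace ℝ ED]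
  {HD : Type*} [TopologicalSpace HD] {I : ModelWithCorners ℝ ED HD}
  {D : Type*} [TopologicalSpace D] [ChartedSpace HD D]
  {EN : Type*} [NormedAddCommGroup EN] [NormedSpace ℝ EN]
  {HN : Type*} [TopologicalSpace HN] {J : ModelWithCorners ℝ EN HN}
  {N : Type*} [TopologicalSpace N] [ChartedSpace HN N]
  {EN' : Type*} [NormedAddCommGroup EN'] [NormedSpace ℝ EN']
  {HN' : Type*} [TopologicalSpace HN'] {J' : ModelWithCorners ℝ EN' HN'}
  {N' : Type*} [TopologicalSpace N'] [ChartedSpace HN' N'] {k : ℕ}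

/-- The curve `φ ∘ γ` has the velocity of `γ` at `0`, if the differential of `φ : EN → N` at
`γ 0 = 0` is the identity. -/
theorem hasMFDerivAt_comp_of_id {φ : EN → N} {γ : ℝ → EN} {v : EN} (h0 : γ 0 = 0)
    (hφ : HasMFDerivAt 𝓘(ℝ, EN) J φ 0 (ContinuousLinearMap.id ℝ EN))
    (hγ : HasDerivAt γ v 0) :
    HasMFDerivAt 𝓘(ℝ, ℝ) J (φ ∘ γ) 0 (ContinuousLinearMap.toSpanSingleton ℝ v : ℝ →L[ℝ] EN) := by
  have h2 : HasMFDerivAt 𝓘(ℝ, ℝ) 𝓘(ℝ, EN) γ 0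
    (ContinuousLinearMap.toSpanSingleton ℝ v : ℝ →L[ℝ] EN) := hγ.hasFDerivAt.hasMFDerivAt
  have h1 : HasMFDerivAt 𝓘(ℝ, EN) J φ (γ 0) (ContinuousLinearMap.id ℝ EN) := by
    rw [h0]; exact hφ
  exact h1.comp (0 : ℝ) h2

/-- Let `v` be the initial velocity of a curve `c` in `N`, and suppose that `f ∘ c` agrees near `0`
with a curve of initial velocity `w`. Then `w` is the image of `v` under the differential
of `f`. -/
theorem eq_mfderiv_of_eventuallyEq {f : N → N'} {c : ℝ → N} {d : ℝ → N'} {v : EN} {w : EN'} {x : N}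
    (hf : MDifferentiableAt J J' f x) (hx : c 0 = x)
    (hc : HasMFDerivAt 𝓘(ℝ, ℝ) J c 0 (ContinuousLinearMap.toSpanSingleton ℝ v : ℝ →L[ℝ] EN))
    (hd : HasMFDerivAt 𝓘(ℝ, ℝ) J' d 0 (ContinuousLinearMap.toSpanSingleton ℝ w : ℝ →L[ℝ] EN'))
    (h : d =ᶠ[𝓝 0] f ∘ c) : w = (mfderiv J J' f x : EN →L[ℝ] EN') v := by
  subst hx
  have h1 := hf.hasMFDerivAt.comp (0 : ℝ) hc
  have h2 := hd.congr_of_eventuallyEq h.symm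
  have h3 := congrArg (fun L : ℝ →L[ℝ] EN' => L 1) (hasMFDerivAt_unique h2 h1)
  exact (one_smul ℝ w).symm.trans (h3.trans
    (congrArg (mfderiv J J' f (c 0) : EN →L[ℝ] EN') (one_smul ℝ v)))

variable [IsManifold J ∞ N] [IsManifold J' ∞ N']
  [CompactSpace D] [T2Space D] [IsManifold I ∞ D]

/-- The evaluation of tangent vectors of `C^k(D, N)` at a point of `D`. -/
def evalL (g : C^k⟮I, D; J, N⟯) (p : D) : Tangent g →L[ℝ] EN :=
  (((trivializationAt EN (g *ᵖ (TangentSpace J : N → Type _)) p).symmL ℝ p).comp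
    (coordL I k (FiberBundle.mem_baseSet_trivializationAt' p)) : Tangent g →L[ℝ] _)

theorem evalL_apply (g : C^k⟮I, D; J, N⟯) (p : D) (s : Tangent g) : evalL g p s = s p :=
  symmL_coord s (FiberBundle.mem_baseSet_trivializationAt' p)

variable [J.Boundaryless] [CompleteSpace EN']

/-- The differential of left-composition with `f` is left-composition with `df`. -/
theorem hasDifferentialAt_compLeft (f : C^∞⟮J, N; J', N'⟯) (g : C^k⟮I, D; J, N⟯) :
    HasDifferentialAt (compLeft f) g (tangentL f g) := by
  intro e e' he he'
  have hG := ((LocalAddition.contDiffAt_chart_compLeft (f := f) he he').differentiableAt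
    (by simp)).hasFDerivAt
  set G := fun σ : Tangent g => e'.chart (compLeft f g) (compLeft f ((e.chart g).symm σ)) with hGdef
  suffices h : fderiv ℝ G 0 = tangentL f g by rwa [h] at hG
  -- Fix a direction `η` and a point `p`: both sides are velocities at `t = 0` of curves through
  -- `f (g p)`.
  ext η p
  let ℓ : ℝ →L[ℝ] Tangent g := ContinuousLinearMap.toSpanSingleton ℝ η
  have hℓ0 : ℓ 0 = 0 := map_zero ℓ
  have hev : ∀ᶠ t in 𝓝 (0 : ℝ), ∀ q, (ℓ t).toMap q ∈ e.liftSource e' f :=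
    ℓ.continuous.continuousAt.eventually (by
      rw [hℓ0]; exact LocalAddition.eventually_mem_liftSource he he')
  have hlift : ∀ᶠ t in 𝓝 (0 : ℝ), (e'.toHomeo ((G (ℓ t)).toMap p)).2 =
      f (e.toHomeo ((ℓ t).toMap p)).2 := by
    filter_upwards [hev] with t ht
    rw [LocalAddition.toMap_chart_compLeft ht, LocalAddition.lift, e'.toHomeo.right_inv (ht p).2]
  -- the curve `t ↦ G (t η) p` in the tangent space at `f (g p)`
  let β : ℝ → EN' := fun t => evalL (compLeft f g) p (G (ℓ t))
  let w : EN' := fderiv ℝ G 0 η p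
  have hβ : HasDerivAt β w 0 := by
    have h1 : HasFDerivAt G (fderiv ℝ G 0) (ℓ 0) := by rwa [hℓ0]
    have h2 := ((evalL (compLeft f g) p).hasFDerivAt.comp (0 : ℝ)
      (h1.comp (0 : ℝ) ℓ.hasFDerivAt)).hasDerivAt
    have h3 : w =
        ((evalL (compLeft f g) p).comp ((fderiv ℝ G 0).comp ℓ)) 1 := by
      change _ = evalL (compLeft f g) p (fderiv ℝ G 0 ((1 : ℝ) • η))
      rw [one_smul, evalL_apply]
    rw [h3]
    exact h2
  have hβG : ∀ t, (⟨f (g p), β t⟩ : TangentBundle J' N') = (G (ℓ t)).toMap p := fun t => by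
    simp only [β]
    rw [evalL_apply]
    rfl
  have hβ0 : β 0 = 0 := by
    have h1 : (⟨f (g p), β 0⟩ : TangentBundle J' N') = ⟨f (g p), 0⟩ := by
      rw [hβG, LocalAddition.toMap_chart_compLeft hev.self_of_nhds, hℓ0]
      change e'.toHomeo.symm (f (g p), f (e.toHomeo (⟨g p, 0⟩ : TangentBundle J N)).2) = _
      rw [e.apply_zero _ (he p)]
      exact (congrArg _ (e'.apply_zero _ (he' p)).symm).trans (e'.toHomeo.left_inv (he' p))
    exact eq_of_heq (TotalSpace.mk.inj h1).2
  let v : EN := η p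
  have hγ : HasDerivAt (fun t : ℝ => t • v) v 0 := by
    simpa using (hasDerivAt_id (0 : ℝ)).smul_const v
  have hc := hasMFDerivAt_comp_of_id (zero_smul ℝ v) (e.hasMFDerivAt_zero _ (he p)) hγ
  have hd := hasMFDerivAt_comp_of_id hβ0 (e'.hasMFDerivAt_zero _ (he' p)) hβ
  have hcx : ((fun u : EN => (e.toHomeo (⟨g p, u⟩ : TangentBundle J N)).2) ∘ fun t : ℝ => t • v) 0 =
      g p := by
    simp only [Function.comp_apply, zero_smul]
    exact congrArg Prod.snd (e.apply_zero _ (he p))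
  have key : w = (mfderiv J J' f (g p) : EN →L[ℝ] EN') v :=
    eq_mfderiv_of_eventuallyEq (f.contMDiff.mdifferentiable (by simp) (g p)) hcx hc hd (by
      filter_upwards [hlift] with t ht
      rw [← hβG] at ht
      exact ht)
  exact key

end Differential

end MappingSpace

end

theorem proposition2p6
    -- the compact manifold `D`, possibly with boundary
    {ED : Type*} [NormedAddCommGroup ED] [NormedSpace ℝ ED] [FiniteDimensional ℝ ED]
    {HD : Type*} [TopologicalSpace HD] (I : ModelWithCorners ℝ ED HD)
    {D : Type*} [TopologicalSpace D] [ChartedSpace HD D] [IsManifold I ∞ D]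
    [CompactSpace D] [T2Space D]
    -- the finite-dimensional manifold `M` and the vector bundle `V → M`
    {EM : Type*} [NormedAddCommGroup EM] [NormedSpace ℝ EM] [FiniteDimensional ℝ EM]
    {HM : Type*} [TopologicalSpace HM] (IM : ModelWithCorners ℝ EM HM) [IM.Boundaryless]
    {M : Type*} [TopologicalSpace M] [ChartedSpace HM M] [IsManifold IM ∞ M] [T2Space M]
    {F : Type*} [NormedAddCommGroup F] [NormedSpace ℝ F] [FiniteDimensional ℝ F]
    {V : M → Type*} [TopologicalSpace (TotalSpace F V)] [∀ x, TopologicalSpace (V x)]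
    [∀ x, AddCommGroup (V x)] [∀ x, Module ℝ (V x)] [∀ x, IsTopologicalAddGroup (V x)]
    [∀ x, ContinuousSMul ℝ (V x)] [FiberBundle F V] [VectorBundle ℝ F V]
    [ContMDiffVectorBundle ∞ F V IM]
    -- the finite-dimensional manifold `M'` and the vector bundle `V' → M'`
    {EM' : Type*} [NormedAddCommGroup EM'] [NormedSpace ℝ EM'] [FiniteDimensional ℝ EM']
    {HM' : Type*} [TopologicalSpace HM'] (IM' : ModelWithCorners ℝ EM' HM') [IM'.Boundaryless]
    {M' : Type*} [TopologicalSpace M'] [ChartedSpace HM' M'] [IsManifold IM' ∞ M'] [T2Space M']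
    {F' : Type*} [NormedAddCommGroup F'] [NormedSpace ℝ F'] [FiniteDimensional ℝ F']
    {V' : M' → Type*} [TopologicalSpace (TotalSpace F' V')] [∀ x, TopologicalSpace (V' x)]
    [∀ x, AddCommGroup (V' x)] [∀ x, Module ℝ (V' x)] [∀ x, IsTopologicalAddGroup (V' x)]
    [∀ x, ContinuousSMul ℝ (V' x)] [FiberBundle F' V'] [VectorBundle ℝ F' V']
    [ContMDiffVectorBundle ∞ F' V' IM']
    (k : ℕ) (hk : 2 ≤ k)
    (P : MappingSpace.Connection IM F V) (P' : MappingSpace.Connection IM' F' V')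
    (T : C^∞⟮IM.prod 𝓘(ℝ, F), TotalSpace F V; IM'.prod 𝓘(ℝ, F'), TotalSpace F' V'⟯)
    (f : C^∞⟮IM, M; IM', M'⟯)
    (hT : MappingSpace.IsAffine P P' T f) :
    MappingSpace.IsAffineMap (I := I) (D := D) (k := k)
      (MappingSpace.naturalConnection P) (MappingSpace.naturalConnection P')
      (MappingSpace.compLeft T) (MappingSpace.compLeft f) := by
  -- the omega lemma needs complete model spaces of the targets
  have := FiniteDimensional.complete ℝ EM'
  have := FiniteDimensional.complete ℝ F'
  refine ⟨MappingSpace.smooth_compLeft f, MappingSpace.smooth_compLeft T,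
    fun S => DFunLike.ext _ _ fun p => hT.proj_eq (S p), fun g => ?_, fun S =>
    ⟨MappingSpace.tangentL T S, MappingSpace.hasDifferentialAt_compLeft T S, fun η =>
      DFunLike.ext _ _ fun p => hT.comm (η.toMap p)⟩⟩
  choose A hA using hT.linear
  have hAT : (fun v : TotalSpace F V => (⟨f v.proj, A v.proj v.2⟩ : TotalSpace F' V')) = T :=
    funext fun v => (hA v.proj v.2).symm
  exact ⟨MappingSpace.morphismL f (fun x => A x) (hAT ▸ T.contMDiff) g,
    fun s => DFunLike.ext _ _ fun p => hA (g p) (s p)⟩
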